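/- Let $\mathcal H$ be a separable complex Hilbert space; times range over $[0,\infty)$. **Data.** Let $\Lambda\ge I$ be a self-adjoint operator and, for $t\ge 0$, let $A_t$ be a normal completely positive map on $\mathcal B(\mathcal H)$, ultraweakly continuous in $t$. The (unbounded) CP-map $\Phi_t$ is given by the quadratic forms $\Phi_t(X)[\psi]=\langle\Lambda^{1/2}\psi,A_t(X)\Lambda^{1/2}\psi\rangle$ on $\mathrm{dom}\,\Lambda^{1/2}$, i.e. $A_t=\Lambda^{-1/2}\Phi_t(\cdot)\Lambda^{-1/2}$. Consider the Markov master equation $$\partial_t P_{\tau,t}(B)=\Phi_t(P_{\tau,t}(B))-G_t^*P_{\tau,t}(B)-P_{\tau,t}(B)G_t,\qquad P_{\tau,\tau}(B)=B. \tag{1.1}$$ **Domain and continuity conditions.** 1. The operators $G_t$ are closed and densely defined, with a joint core $\mathcal D$ such that $\mathcal D\subseteq\mathrm{dom}\,G_t^N$ for some $N\ge2$ and $\mathcal D\subseteq \mathrm{dom}\,\Lambda^{1/2}$. 2. There is a strongly continuous family of contractions $W_{s,t}$ $(0\le s\le t)$ with $W_{t,t}=I$, $W_{s,r}W_{r,t}=W_{s,t}$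 for $s\le r\le t$, $W_{s,t}\mathcal D\subseteq\mathcal D$, and, strongly on $\mathcal D$, $\partial_tW_{s,t}=-W_{s,t}G_t$ and $\partial_sW_{s,t}=G_sW_{s,t}$. 3. $\Lambda\ge\Phi_t(I)\ge I$ as forms on $\mathrm{dom}\,\Lambda^{1/2}$, and $G_t^*+G_t=\Phi_t(I)$ as forms on $\mathcal D$. 4. For every $\psi\in\mathcal D$, $\Lambda^{1/2}W_{s,t}\psi$ is square integrable in $s\in[0,t]$ and norm-continuous in $t\in[s,\infty)$. **Minimal solution.** Let $P^{(0)}_{\tau,t}(B)=W_{\tau,t}^*BW_{\tau,t}$, and let $P^{(n+1)}_{\tau,t}(B)$ be the bounded operator determined by $$\langle\psi,P^{(n+1)}_{\tau,t}(B)\psi\rangle=\langle W_{\tau,t}\psi,BW_{\tau,t}\psi\rangle+\int_\tau^t\Phi_s\bigl(P^{(n)}_{\tau,s}(B)\bigr)[W_{s,t}\psi]\,ds\qquad(\psi\in\mathcal D).$$ For $B\ge0$ the minimal solution of (1.1) is $P^{\min}_{\tau,t}(B)=\mathrm{l.u.b.}_n\,P^{(n)}_{\tau,t}(B)$. For a positive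 self-adjoint unbounded $T$, the forms $\Phi_t(T)[\psi]$ and $P^{\min}_{\tau,t}(T)[\psi]$, with values in $[0,\infty]$, are the suprema of $\Phi_t(X)[\psi]$ and $P^{\min}_{\tau,t}(X)[\psi]$ over bounded $X$ with $0\le X\le T$. **Reference family.** A family of self-adjoint operators $\Lambda_t\ge I$ $(t\ge0)$ is a reference family if: 1. $\mathcal D\subseteq\mathrm{dom}\,\Lambda_t$, $\mathcal D$ is a core of $\Lambda_t^{1/2}$, and $\Lambda_t\ge\Phi_t(I)$ as forms on $\mathcal D$. 2. For $\psi\in\mathcal D$ the map $t\mapsto\Lambda_t\psi$ is differentiable, with derivative denoted $\dot\Lambda_t\psi$, and $s\mapsto\|\Lambda_s^{1/2}W_{s,t}\psi\|^2$ is continuous on $[0,t]$. 3. The operators $\Lambda^{-1/2}\Lambda_t\Lambda^{-1/2}$ are densely defined and have continuations to $\mathcal H$ that are uniformly bounded and strongly continuous in $t$. 4. There is $c\in L_1^{loc}([0,\infty))$, $c_t\ge0$, such that for all $t\ge0$ and $\psi\in\mathcal D$ $$\Phi_t(\Lambda_t)[\psi]-2\,\mathrm{Re}\,\langle G_t\psi,\Lambda_t\psi\rangle-\langle\psi,\dot\Lambda_t\psi\rangle\le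 c_t\,\|\Lambda_t^{1/2}\psi\|^2 .\tag{2.1}$$ **Theorem.** Assume the domain and continuity conditions, and let $(\Lambda_t)$ be a reference family with rate $c$. Then all $P^{(n)}_{\tau,t}(B)$ with $B\in\mathcal B(\mathcal H)$, and all $P^{\min}_{\tau,t}(B)$ with $B\ge 0$, are well defined. For all $0\le\tau\le t$ the a priori bound $$P^{\min}_{\tau,t}(\Lambda_\tau)\le\Lambda_t\,\exp\Bigl(\int_\tau^tc_s\,ds\Bigr)$$ holds as forms on $\mathrm{dom}\,\Lambda_t^{1/2}$. Moreover the minimal solution of (1.1) is unital: $P^{\min}_{\tau,t}(I)=I$ for all $0\le\tau\le t$. -/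

import Mathlib

open Set MeasureTheory
open scoped ENNReal InnerProductSpace CStarAlgebra

noncomputable section

namespace MME

variable {H : Type*} [NormedAddCommGroup H] [InnerProductSpace ℂ H] [CompleteSpace H]

/-! ### Unbounded operators -/

/-- The value `T x` of an unbounded operator, extended by `0` outside the domain of `T`. -/
def ev (T : H →ₗ.[ℂ] H) (x : H) : H :=
  open Classical in if h : x ∈ T.domain then T ⟨x, h⟩ else 0

/-- The domain of the power `T ^ n`. -/
def domPow (T : H →ₗ.[ℂ] H) : ℕ → Set H
  | 0 => univ
  | n + 1 => {x | x ∈ T.domain ∧ ev T x ∈ domPow T n}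

/-- `T` is self-adjoint and `T ≥ I`. -/
structure IsSelfAdjointGeOne (T : H →ₗ.[ℂ] H) : Prop where
  isSelfAdjoint : IsSelfAdjoint T
  one_le : ∀ x : T.domain, ‖(x : H)‖ ^ 2 ≤ (⟪(x : H), T x⟫_ℂ).re

/-- The bounded operator `R` is the two-sided inverse of the unbounded operator `T`. -/
def IsInverse (T : H →ₗ.[ℂ] H) (R : H →L[ℂ] H) : Prop :=
  (∀ y : H, ∃ h : R y ∈ T.domain, T ⟨R y, h⟩ = y) ∧ ∀ x : T.domain, R (T x) = x

/-- The bounded inverse `T⁻¹` (it exists for every self-adjoint `T ≥ I`). -/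
def inv (T : H →ₗ.[ℂ] H) : H →L[ℂ] H :=
  open Classical in if h : ∃ R, IsInverse T R then h.choose else 0

/-- The bounded positive operator `T^{-1/2}`, for self-adjoint `T ≥ I`. -/
def invSqrt (T : H →ₗ.[ℂ] H) : H →L[ℂ] H := CFC.sqrt (inv T)

/-- The positive self-adjoint square root `T^{1/2}`, for self-adjoint `T ≥ I`: the inverse of the
injective bounded operator `T^{-1/2}`, with domain the range of `T^{-1/2}`. -/
def sqrtOp (T : H →ₗ.[ℂ] H) : H →ₗ.[ℂ] H :=
  (((invSqrt T : H →L[ℂ] H) : H →ₗ[ℂ] H).toPMap ⊤).inverse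

/-- `X ≤ T` in the sense of quadratic forms, for a bounded `X` and an unbounded self-adjoint `T`. -/
def LeOp (X : H →L[ℂ] H) (T : H →ₗ.[ℂ] H) : Prop :=
  ∀ x : T.domain, (⟪(x : H), X x⟫_ℂ).re ≤ (⟪(x : H), T x⟫_ℂ).re

/-- Canonical extension of a monotone map `m`, sending bounded positive operators to quadratic
forms, to a positive self-adjoint operator `T`: the form
`ψ ↦ sup {m(X)[ψ] : X bounded, 0 ≤ X ≤ T}`, with values in `[0, ∞]`. If `m(X) = ∑ₖ Lₖ* X Lₖ`,
this is `∑ₖ ‖T^{1/2} Lₖ ψ‖²`. -/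
def extendForm (m : (H →L[ℂ] H) → H → ℂ) (T : H →ₗ.[ℂ] H) (ψ : H) : ℝ≥0∞ :=
  ⨆ (X : H →L[ℂ] H) (_ : 0 ≤ X) (_ : LeOp X T), ENNReal.ofReal (m X ψ).re

/-! ### Ultraweak topology -/

/-- Ultraweakly continuous functionals on `B(H)`: `X ↦ ∑ₙ ⟨xₙ, X yₙ⟩` with
`∑ₙ ‖xₙ‖² < ∞` and `∑ₙ ‖yₙ‖² < ∞`. -/
def IsUltraweak (ω : (H →L[ℂ] H) →ₗ[ℂ] ℂ) : Prop :=
  ∃ x y : ℕ → H, Summable (fun n => ‖x n‖ ^ 2) ∧ Summable (fun n => ‖y n‖ ^ 2) ∧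
    ∀ X : H →L[ℂ] H, HasSum (fun n => ⟪x n, X (y n)⟫_ℂ) (ω X)

/-- A linear map on `B(H)` is normal if it is ultraweakly continuous, i.e. if it pulls ultraweakly
continuous functionals back to ultraweakly continuous functionals. -/
def IsNormalMap (A : (H →L[ℂ] H) →ₗ[ℂ] (H →L[ℂ] H)) : Prop :=
  ∀ ω : (H →L[ℂ] H) →ₗ[ℂ] ℂ, IsUltraweak ω → IsUltraweak (ω ∘ₗ A)

/-! ### Bounded operators from densely defined forms -/

/-- The bounded operator whose quadratic form on `D` is `q` (unique if `D` is dense), and `0` if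
there is none. -/
def opOfForm (D : Submodule ℂ H) (q : H → ℂ) : H →L[ℂ] H :=
  open Classical in if h : ∃ T : H →L[ℂ] H, ∀ ψ ∈ D, ⟪ψ, T ψ⟫_ℂ = q ψ then h.choose else 0

end MME

/-- The data of a time-dependent Markov master equation on `B(H)`,
`∂ₜ P = Φₜ(P) - Gₜ* P - P Gₜ`, for times `t ≥ 0`: a dominating operator `Λ`, the maps
`Aₜ = Λ^{-1/2} Φₜ(·) Λ^{-1/2}` (which encode the unbounded CP-maps `Φₜ`), the operators `Gₜ`, the
evolution system `W s t`, and the joint core `D ⊆ dom Gₜ^N`. -/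
structure MarkovMasterEquation (H : Type*) [NormedAddCommGroup H] [InnerProductSpace ℂ H]
    [CompleteSpace H] where
  Λ : H →ₗ.[ℂ] H
  A : ℝ → ((H →L[ℂ] H) →CP (H →L[ℂ] H))
  G : ℝ → (H →ₗ.[ℂ] H)
  W : ℝ → ℝ → (H →L[ℂ] H)
  D : Submodule ℂ H
  N : ℕ

namespace MarkovMasterEquation

open MME

variable {H : Type*} [NormedAddCommGroup H] [InnerProductSpace ℂ H] [CompleteSpace H]
  (M : MarkovMasterEquation H)

/-- `Λ^{1/2} x` (for `x ∈ dom Λ^{1/2}`). -/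
def sq (x : H) : H := ev (sqrtOp M.Λ) x

/-- The sesquilinear form of `Φₜ(X) = Λ^{1/2} Aₜ(X) Λ^{1/2}`, on `dom Λ^{1/2}`. -/
def phi (t : ℝ) (X : H →L[ℂ] H) (φ ψ : H) : ℂ := ⟪M.sq φ, M.A t X (M.sq ψ)⟫_ℂ

/-- The quadratic form `Φₜ(T)[ψ] ∈ [0, ∞]` for positive self-adjoint unbounded `T`. -/
def phiExt (t : ℝ) (T : H →ₗ.[ℂ] H) (ψ : H) : ℝ≥0∞ :=
  extendForm (fun X ψ => M.phi t X ψ ψ) T ψ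

/-- Strongly continuous contractive evolution system `W s t`, `0 ≤ s ≤ t`, generated by `Gₜ`:
`∂ₜ W s t = - W s t Gₜ` and `∂ₛ W s t = Gₛ W s t` strongly on the invariant core `D`. -/
structure IsEvolutionSystem : Prop where
  norm_le : ∀ s t, 0 ≤ s → s ≤ t → ‖M.W s t‖ ≤ 1
  refl : ∀ t, 0 ≤ t → M.W t t = 1
  comp : ∀ s r t, 0 ≤ s → s ≤ r → r ≤ t → M.W s r * M.W r t = M.W s t
  continuousOn : ∀ ψ : H,
    ContinuousOn (fun p : ℝ × ℝ => M.W p.1 p.2 ψ) {p | 0 ≤ p.1 ∧ p.1 ≤ p.2}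
  maps_core : ∀ s t, 0 ≤ s → s ≤ t → ∀ ψ ∈ M.D, M.W s t ψ ∈ M.D
  deriv_right : ∀ s t, 0 ≤ s → s ≤ t → ∀ ψ ∈ M.D,
    HasDerivWithinAt (fun r => M.W s r ψ) (-(M.W s t (ev (M.G t) ψ))) (Ici s) t
  deriv_left : ∀ s t, 0 ≤ s → s ≤ t → ∀ ψ ∈ M.D,
    HasDerivWithinAt (fun r => M.W r t ψ) (ev (M.G s) (M.W s t ψ)) (Icc 0 t) s

/-- The domain and continuity conditions. -/
structure DomainContinuity : Prop where
  evolution : M.IsEvolutionSystem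
  two_le_N : 2 ≤ M.N
  G_dense : ∀ t, 0 ≤ t → Dense ((M.G t).domain : Set H)
  G_closed : ∀ t, 0 ≤ t → (M.G t).IsClosed
  core : ∀ t, 0 ≤ t → (M.G t).HasCore M.D
  core_pow : ∀ t, 0 ≤ t → (M.D : Set H) ⊆ domPow (M.G t) M.N
  Λ_ge : IsSelfAdjointGeOne M.Λ
  D_le : M.D ≤ (sqrtOp M.Λ).domain
  /-- `Gₜ* + Gₜ = Φₜ(I)` on `D` (as forms) -/
  G_add_adjoint : ∀ t, 0 ≤ t → ∀ φ ∈ M.D, ∀ ψ ∈ M.D,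
    ⟪ev (M.G t) φ, ψ⟫_ℂ + ⟪φ, ev (M.G t) ψ⟫_ℂ = M.phi t 1 φ ψ
  /-- `Λ ≥ Φₜ(I)` -/
  phi_one_le : ∀ t, 0 ≤ t → ∀ ψ ∈ (sqrtOp M.Λ).domain, (M.phi t 1 ψ ψ).re ≤ ‖M.sq ψ‖ ^ 2
  /-- `Φₜ(I) ≥ I` -/
  one_le_phi : ∀ t, 0 ≤ t → ∀ ψ ∈ (sqrtOp M.Λ).domain, ‖ψ‖ ^ 2 ≤ (M.phi t 1 ψ ψ).re
  normal : ∀ t, 0 ≤ t → IsNormalMap (M.A t).toLinearMap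
  ultraweak_continuous : ∀ X : H →L[ℂ] H, ∀ ω : (H →L[ℂ] H) →ₗ[ℂ] ℂ, IsUltraweak ω →
    ContinuousOn (fun t => ω (M.A t X)) (Ici 0)
  sq_memLp : ∀ ψ ∈ M.D, ∀ t, 0 ≤ t →
    MemLp (fun s => M.sq (M.W s t ψ)) 2 (volume.restrict (Icc 0 t))
  sq_continuous : ∀ ψ ∈ M.D, ∀ s, 0 ≤ s →
    ContinuousOn (fun t => M.sq (M.W s t ψ)) (Ici s)

/-- `L t`, `t ≥ 0`, is a reference family with rate `c`. -/
structure IsReferenceFamily (L : ℝ → (H →ₗ.[ℂ] H)) (c : ℝ → ℝ) : Prop where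
  ge_one : ∀ t, 0 ≤ t → IsSelfAdjointGeOne (L t)
  D_le : ∀ t, 0 ≤ t → M.D ≤ (L t).domain
  core : ∀ t, 0 ≤ t → (sqrtOp (L t)).HasCore M.D
  phi_one_le : ∀ t, 0 ≤ t → ∀ ψ ∈ M.D, (M.phi t 1 ψ ψ).re ≤ ‖ev (sqrtOp (L t)) ψ‖ ^ 2
  /-- strong differentiability on `D`, with `D ⊆ dom (dL/dt)` -/
  differentiable : ∀ ψ ∈ M.D, DifferentiableOn ℝ (fun t => ev (L t) ψ) (Ici 0)
  /-- continuity along the evolution system -/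
  continuous_along : ∀ ψ ∈ M.D, ∀ t, 0 ≤ t →
    ContinuousOn (fun s => ‖ev (sqrtOp (L s)) (M.W s t ψ)‖ ^ 2) (Icc 0 t)
  /-- `Λ^{-1/2} L t Λ^{-1/2}` is densely defined and has a uniformly bounded, strongly continuous
  continuation to `H`. -/
  relatively_bounded :
    (∀ t, 0 ≤ t → Dense {x : H | invSqrt M.Λ x ∈ (L t).domain}) ∧
    ∃ B : ℝ → (H →L[ℂ] H),
      (∀ t, 0 ≤ t → ∀ x, invSqrt M.Λ x ∈ (L t).domain →
        B t x = invSqrt M.Λ (ev (L t) (invSqrt M.Λ x))) ∧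
      (∃ K : ℝ, ∀ t, 0 ≤ t → ‖B t‖ ≤ K) ∧
      ∀ x : H, ContinuousOn (fun t => B t x) (Ici 0)
  rate_nonneg : ∀ t, 0 ≤ t → 0 ≤ c t
  rate_integrable : LocallyIntegrableOn c (Ici 0)
  /-- the differential inequality -/
  inequality : ∀ t, 0 ≤ t → ∀ ψ ∈ M.D, M.phiExt t (L t) ψ ≠ ∞ ∧
    (M.phiExt t (L t) ψ).toReal - 2 * (⟪ev (M.G t) ψ, ev (L t) ψ⟫_ℂ).re
      - (⟪ψ, derivWithin (fun r => ev (L r) ψ) (Ici 0) t⟫_ℂ).re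
      ≤ c t * ‖ev (sqrtOp (L t)) ψ‖ ^ 2

/-- The successive approximations: `P⁽⁰⁾(B) = W* B W`, and `P⁽ⁿ⁺¹⁾(B)` is the bounded operator with
form `V_{τ,t}(B)[ψ] + ∫_τ^t Φₛ(P⁽ⁿ⁾_{τ,s}(B))[W s t ψ] ds`, `ψ ∈ D`. -/
def P : ℕ → ℝ → ℝ → (H →L[ℂ] H) → (H →L[ℂ] H)
  | 0, τ, t, B => star (M.W τ t) * B * M.W τ t
  | n + 1, τ, t, B => opOfForm M.D fun ψ =>
      ⟪M.W τ t ψ, B (M.W τ t ψ)⟫_ℂ +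
        ∫ s in τ..t, M.phi s (P n τ s B) (M.W s t ψ) (M.W s t ψ)

/-- `P⁽ⁿ⁺¹⁾` is well defined: the integral converges and the form on `D` is that of a bounded
operator. -/
def IteratesWellDefined : Prop :=
  ∀ (n : ℕ) (τ t : ℝ), 0 ≤ τ → τ ≤ t → ∀ B : H →L[ℂ] H, ∀ ψ ∈ M.D,
    IntervalIntegrable (fun s => M.phi s (M.P n τ s B) (M.W s t ψ) (M.W s t ψ)) volume τ t ∧
    ⟪ψ, M.P (n + 1) τ t B ψ⟫_ℂ = ⟪M.W τ t ψ, B (M.W τ t ψ)⟫_ℂ +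
      ∫ s in τ..t, M.phi s (M.P n τ s B) (M.W s t ψ) (M.W s t ψ)

/-- The minimal solution on `B ≥ 0`: the least upper bound of the successive approximations. -/
def Pmin (τ t : ℝ) (B : H →L[ℂ] H) : H →L[ℂ] H :=
  open Classical in if h : ∃ T, IsLUB (range fun n => M.P n τ t B) T then h.choose else 0

/-- The quadratic form of the minimal solution at a positive self-adjoint unbounded `T`. -/
def PminExt (τ t : ℝ) (T : H →ₗ.[ℂ] H) (ψ : H) : ℝ≥0∞ :=
  extendForm (fun X ψ => ⟪ψ, M.Pmin τ t X ψ⟫_ℂ) T ψ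

end MarkovMasterEquation

end

/-! Everything rests on one function, `f s = ‖Λₛ^{1/2} W s t ψ‖²` with `ψ ∈ D`. Since `∂ₛ W = Gₛ W`,
its formal derivative at `u = W s t ψ` is `2 Re⟨Gₛ u, Λₛ u⟩ + ⟨u, Λ̇ₛ u⟩`, which by the differential
inequality is at least `Φₛ(Λₛ)[u] - cₛ f s`. The product rule is not available, because `Λᵣ` is
applied to the moving vector `W r t ψ`; but positivity of `Λᵣ` still gives this lower bound for the
lower right Dini derivative (`dini_reference`), and that suffices for an integral inequality.

If `Yₛ ≥ 0` satisfies `Yₛ ≤ exp(∫_τ^s (c + κ)) Λₛ`, then `Φₛ(Yₛ)` is at most the same multiple of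
`Φₛ(Λₛ)`. A Grönwall argument with integrable `c` then yields (`reference_integral_le`) `f τ + ∫_τ^t
(Φₛ(Yₛ)[W s t ψ] + κ f s) ds ≤ exp(∫_τ^t (c + κ)) ‖Λₜ^{1/2} ψ‖²`. The left side has the shape of the
recursion for the successive approximations, so the estimate closes inductions on `n`.

A priori bound: take `κ = 0`, `Yₛ = P⁽ⁿ⁾_{τ,s}(X)` with `0 ≤ X ≤ Λ_τ`, then let `n → ∞` and take the
supremum over `X`.

Unitality: from `Gₛ* + Gₛ = Φₛ(I)` comes the energy balance `‖ψ‖² - ‖W τ t ψ‖² = ∫ Φₛ(I)[W s t ψ]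
ds`. So the defects `Q_k = I - P⁽ᵏ⁾(I)` satisfy `Q_0[ψ] = ∫ Φₛ(I)[W s t ψ] ds` and `Q_{k+1}[ψ] = ∫
Φₛ(Q_k)[W s t ψ] ds`. Their partial sums obey the same recursion with the source `Φₛ(I) ≤ Λₛ`, which
the choice `κ = 1` absorbs, and are therefore bounded by `exp(∫ (c + 1)) Λₜ` uniformly in `n`. Each
`Q_k` dominates `Q = I - Pmin(I) ≥ 0`, so `n Q` is bounded in form on `D` for all `n`, and `Q = 0`.

The rest is well-definedness: the integrals need measurability of `s ↦ Φₛ(P⁽ⁿ⁾_{τ,s}(B))[W s t ψ]`,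
and the energy balance turns bounds by `Φₛ(I)` into bounds by `‖ψ‖²`. -/

section Development

open Filter Topology

noncomputable section

namespace MME

/-! ### Integral inequalities on the line -/

/-- If the upper right Dini derivative of a continuous function `g` is bounded by an integrable
function `φ`, then the increments of `g` are bounded by the integrals of `φ`. -/
theorem sub_le_integral_of_dini_le {g φ : ℝ → ℝ} {a b : ℝ} (hab : a ≤ b)
    (hcont : ContinuousOn g (Icc a b)) (φint : IntegrableOn φ (Icc a b))
    (hdini : ∀ x ∈ Ico a b, ∀ y, φ x < y → ∀ᶠ u in 𝓝[>] x, g u - g x ≤ (u - x) * y) :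
    g b - g a ≤ ∫ y in a..b, φ y := by
  refine le_of_forall_pos_le_add fun ε εpos => ?_
  -- Vitali–Carathéodory: `φ` is replaced by a lower semicontinuous majorant at the cost of `ε`. A
  -- strict lower bound on the majorant at `t` then persists near `t`, which is not true of a merely
  -- integrable `φ`.
  rcases exists_lt_lowerSemicontinuous_integral_lt φ φint εpos with
    ⟨G', f_lt_G', G'cont, G'int, G'lt_top, hG'⟩
  set s := {t | g t - g a ≤ ∫ u in a..t, (G' u).toReal} ∩ Icc a b
  have s_closed : IsClosed s := by
    have : ContinuousOn (fun t => (g t - g a, ∫ u in a..t, (G' u).toReal)) (Icc a b) := by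
      rw [← uIcc_of_le hab] at G'int hcont ⊢
      exact (hcont.sub continuousOn_const).prodMk
        (intervalIntegral.continuousOn_primitive_interval G'int)
    simp only [s, inter_comm]
    exact this.preimage_isClosed_of_isClosed isClosed_Icc OrderClosedTopology.isClosed_le'
  have main : Icc a b ⊆ {t | g t - g a ≤ ∫ u in a..t, (G' u).toReal} := by
    -- Continuous induction: the set of good `t` is closed and contains `a`, and from each of its
    -- points in `[a, b)` it extends to the right.
    refine s_closed.Icc_subset_of_forall_exists_gt
      (by simp only [intervalIntegral.integral_same, mem_ofPred_eq, sub_self, le_rfl])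
      fun t ht v t_lt_v => ?_
    obtain ⟨y, φ_lt_y, y_lt_G'⟩ : ∃ y : ℝ, (φ t : EReal) < y ∧ (y : EReal) < G' t :=
      EReal.lt_iff_exists_real_btwn.1 (f_lt_G' t)
    have I1 : ∀ᶠ u in 𝓝[>] t, (u - t) * y ≤ ∫ w in t..u, (G' w).toReal := by
      have B : ∀ᶠ u in 𝓝 t, (y : EReal) < G' u := G'cont.lowerSemicontinuousAt _ _ y_lt_G'
      rcases mem_nhds_iff_exists_Ioo_subset.1 B with ⟨m, M, ⟨hm, hM⟩, H⟩
      have : Ioo t (min M b) ∈ 𝓝[>] t := Ioo_mem_nhdsGT (lt_min hM ht.right.right)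
      filter_upwards [this] with u hu
      have I : Icc t u ⊆ Icc a b := Icc_subset_Icc ht.2.1 (hu.2.le.trans (min_le_right _ _))
      calc
        (u - t) * y = ∫ _ in Icc t u, y := by
          simp only [MeasureTheory.integral_const, MeasurableSet.univ, measureReal_restrict_apply,
            univ_inter, hu.left.le, Real.volume_real_Icc_of_le, smul_eq_mul]
        _ ≤ ∫ w in t..u, (G' w).toReal := by
          rw [intervalIntegral.integral_of_le hu.1.le, ← integral_Icc_eq_integral_Ioc]
          apply setIntegral_mono_ae_restrict
          · simp
          · exact IntegrableOn.mono_set G'int I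
          · have C1 : ∀ᵐ x : ℝ ∂volume.restrict (Icc t u), G' x < ∞ :=
              ae_mono (Measure.restrict_mono I le_rfl) G'lt_top
            have C2 : ∀ᵐ x : ℝ ∂volume.restrict (Icc t u), x ∈ Icc t u :=
              ae_restrict_mem measurableSet_Icc
            filter_upwards [C1, C2] with x G'x hx
            apply EReal.coe_le_coe_iff.1
            have : x ∈ Ioo m M := by
              simp only [hm.trans_le hx.left,
                (hx.right.trans_lt hu.right).trans_le (min_le_left M b), mem_Ioo, and_self_iff]
            refine (H this).out.le.trans_eq ?_
            exact (EReal.coe_toReal G'x.ne (f_lt_G' x).ne_bot).symm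
    have I3 : ∀ᶠ u in 𝓝[>] t, g u - g t ≤ ∫ w in t..u, (G' w).toReal := by
      filter_upwards [I1, hdini t ht.2 y (EReal.coe_lt_coe_iff.1 φ_lt_y)] with u hu1 hu2
        using hu2.trans hu1
    have I4 : ∀ᶠ u in 𝓝[>] t, u ∈ Ioc t (min v b) := Ioc_mem_nhdsGT <| lt_min t_lt_v ht.2.2
    rcases (I3.and I4).exists with ⟨x, hx, h'x⟩
    refine ⟨x, ?_, Ioc_subset_Ioc le_rfl (min_le_left _ _) h'x⟩
    calc
      g x - g a = g t - g a + (g x - g t) := by abel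
      _ ≤ (∫ w in a..t, (G' w).toReal) + ∫ w in t..x, (G' w).toReal := add_le_add ht.1 hx
      _ = ∫ w in a..x, (G' w).toReal := by
        apply intervalIntegral.integral_add_adjacent_intervals
        · rw [intervalIntegrable_iff_integrableOn_Ioc_of_le ht.2.1]
          exact IntegrableOn.mono_set G'int
            (Ioc_subset_Icc_self.trans (Icc_subset_Icc le_rfl ht.2.2.le))
        · rw [intervalIntegrable_iff_integrableOn_Ioc_of_le h'x.1.le]
          apply IntegrableOn.mono_set G'int
          exact Ioc_subset_Icc_self.trans (Icc_subset_Icc ht.2.1 (h'x.2.trans (min_le_right _ _)))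
  calc
    g b - g a ≤ ∫ y in a..b, (G' y).toReal := main (right_mem_Icc.2 hab)
    _ ≤ (∫ y in a..b, φ y) + ε := by
      convert! hG'.le <;>
        · rw [intervalIntegral.integral_of_le hab]
          simp only [integral_Icc_eq_integral_Ioc', Real.volume_singleton]

/-- The exponential of an absolutely continuous function is absolutely continuous. -/
theorem absolutelyContinuousOnInterval_exp {f : ℝ → ℝ} {a b : ℝ}
    (hf : AbsolutelyContinuousOnInterval f a b) :
    AbsolutelyContinuousOnInterval (fun x => Real.exp (f x)) a b := by
  obtain ⟨C, hC⟩ := hf.exists_bound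
  have hlip : ∀ x ∈ uIcc a b, ∀ y ∈ uIcc a b,
      dist (Real.exp (f x)) (Real.exp (f y)) ≤ Real.exp C * dist (f x) (f y) := by
    intro x hx y hy
    have h := Convex.norm_image_sub_le_of_norm_deriv_le (𝕜 := ℝ) (f := Real.exp) (C := Real.exp C)
      (s := Icc (-C) C) (fun z _ => Real.differentiable_exp z)
      (fun z hz => by simpa using hz.2) (convex_Icc _ _) (abs_le.1 (hC y hy)) (abs_le.1 (hC x hx))
    rwa [← dist_eq_norm, ← dist_eq_norm] at h
  rw [absolutelyContinuousOnInterval_iff] at hf ⊢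
  intro ε hε
  obtain ⟨δ, hδ, h⟩ := hf (ε / Real.exp C) (by positivity)
  refine ⟨δ, hδ, fun E hE hlt => ?_⟩
  have h1 := h E hE hlt
  rw [lt_div_iff₀ (by positivity)] at h1
  refine lt_of_le_of_lt ?_ h1
  rw [Finset.sum_mul]
  refine Finset.sum_le_sum fun i hi => ?_
  have := hE.1 i hi
  rw [mul_comm]
  exact hlip _ this.1 _ this.2

/-- A Grönwall inequality with integrable coefficients. -/
theorem integral_le_exp_mul_sub {f q c : ℝ → ℝ} {a b : ℝ} (hab : a ≤ b)
    (hf : ContinuousOn f (Icc a b)) (hc : IntervalIntegrable c volume a b)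
    (hq : IntervalIntegrable q volume a b) (hc0 : ∀ s ∈ Icc a b, 0 ≤ c s)
    (h : ∀ s ∈ Icc a b,
      ∫ r in s..b, (Real.exp (-∫ x in a..r, c x) * q r - c r * f r) ≤ f b - f s) :
    ∫ r in a..b, q r ≤ Real.exp (∫ x in a..b, c x) * f b - f a := by
  -- With `k` the primitive of `κ`, the hypothesis says exactly that `f - k` is bounded on `[a, b]`
  -- by its value at `b`. As `f` need not be absolutely continuous, the product rule is applied to
  -- `e^C k` instead: `(e^C k)' = q - c e^C (f - k)` almost everywhere. Integrating, and using `∫ c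
  -- e^C = e^{C b} - 1`, leaves only the values of `f - k` at the endpoints.
  set C : ℝ → ℝ := fun r => ∫ x in a..r, c x with hC
  set κ : ℝ → ℝ := fun r => Real.exp (-C r) * q r - c r * f r with hκ
  set k : ℝ → ℝ := fun r => ∫ x in a..r, κ x with hk
  have hCac : AbsolutelyContinuousOnInterval C a b :=
    hc.absolutelyContinuousOnInterval_intervalIntegral left_mem_uIcc
  have hEac := absolutelyContinuousOnInterval_exp hCac
  have hu : uIcc a b = Icc a b := uIcc_of_le hab
  have hκi : IntervalIntegrable κ volume a b := by
    refine (hq.continuousOn_mul ?_).sub (hc.mul_continuousOn (by rwa [hu]))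
    exact Real.continuous_exp.comp_continuousOn hCac.continuousOn.neg
  have hkac : AbsolutelyContinuousOnInterval k a b :=
    hκi.absolutelyContinuousOnInterval_intervalIntegral left_mem_uIcc
  have hac := hEac.mul hkac
  have hkc : ContinuousOn k (Icc a b) := by simpa [hu] using hkac.continuousOn
  have hEc : ContinuousOn (fun r => Real.exp (C r)) (Icc a b) := by
    simpa [hu] using hEac.continuousOn
  have hderC : ∀ᵐ x, x ∈ uIcc a b → HasDerivAt C (c x) x := by
    filter_upwards [hc.ae_hasDerivAt_integral] with x hx hxm using hx hxm a left_mem_uIcc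
  have hderk : ∀ᵐ x, x ∈ uIcc a b → HasDerivAt k (κ x) x := by
    filter_upwards [hκi.ae_hasDerivAt_integral] with x hx hxm using hx hxm a left_mem_uIcc
  have hcE : IntervalIntegrable (fun x => c x * Real.exp (C x)) volume a b :=
    hc.mul_continuousOn (by rwa [hu])
  have hcEh : IntervalIntegrable (fun x => c x * Real.exp (C x) * (f x - k x)) volume a b :=
    hcE.mul_continuousOn (by rw [hu]; exact hf.sub hkc)
  have e1 : ∫ x in a..b, c x * Real.exp (C x) = Real.exp (C b) - 1 := by
    have h1 := hEac.integral_deriv_eq_sub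
    rw [intervalIntegral.integral_congr_ae (g := fun x => c x * Real.exp (C x))] at h1
    · simpa [hC] using h1
    · filter_upwards [hderC] with x hx hxm
      rw [(hx (uIoc_subset_uIcc hxm)).exp.deriv, mul_comm]
  have e2 : Real.exp (C b) * k b =
      (∫ x in a..b, q x) - ∫ x in a..b, c x * Real.exp (C x) * (f x - k x) := by
    have h1 := hac.integral_deriv_eq_sub
    rw [intervalIntegral.integral_congr_ae
      (g := fun x => q x - c x * Real.exp (C x) * (f x - k x))] at h1
    · rw [intervalIntegral.integral_sub hq hcEh] at h1
      rw [h1]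
      simp [hk]
    · filter_upwards [hderC, hderk] with x hx hx' hxm
      have hm := uIoc_subset_uIcc hxm
      have hd := (hx hm).exp.mul (hx' hm)
      have : HasDerivAt ((fun x => Real.exp (C x)) * k)
          (Real.exp (C x) * c x * k x + Real.exp (C x) * κ x) x := hd
      rw [this.deriv, hκ]
      have : Real.exp (C x) * Real.exp (-C x) = 1 := by rw [← Real.exp_add]; simp
      linear_combination (q x) * this
  have hmono : ∀ s ∈ Icc a b, f s - k s ≤ f b - k b := by
    intro s hs
    have h1 := h s hs
    have h2 : k b = k s + ∫ r in s..b, κ r := by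
      rw [hk]
      refine (intervalIntegral.integral_add_adjacent_intervals ?_ ?_).symm
      · exact hκi.mono_set (by rw [hu, uIcc_of_le hs.1]; exact Icc_subset_Icc le_rfl hs.2)
      · exact hκi.mono_set (by rw [hu, uIcc_of_le hs.2]; exact Icc_subset_Icc hs.1 le_rfl)
    have h1' : ∫ r in s..b, κ r ≤ f b - f s := h1
    linarith
  have e3 : ∫ x in a..b, c x * Real.exp (C x) * (f x - k x) ≤
      (Real.exp (C b) - 1) * (f b - k b) := by
    rw [← e1, ← intervalIntegral.integral_mul_const]
    refine intervalIntegral.integral_mono_on hab hcEh (hcE.mul_const _) fun x hx => ?_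
    exact mul_le_mul_of_nonneg_left (hmono x hx) (mul_nonneg (hc0 x hx) (Real.exp_pos _).le)
  have e4 := hmono a (left_mem_Icc.2 hab)
  have e5 : k a = 0 := by simp [hk]
  have e6 : Real.exp (C b) * (k b) + (Real.exp (C b) - 1) * (f b - k b)
    = Real.exp (C b) * f b - (f b - k b) := by ring
  rw [e5] at e4
  linarith

end MME

namespace MME

set_option linter.unusedSectionVars false

variable {H : Type*} [NormedAddCommGroup H] [InnerProductSpace ℂ H] [CompleteSpace H]

/-! ### Unbounded operators -/

theorem ev_of_mem {T : H →ₗ.[ℂ] H} {x : H} (h : x ∈ T.domain) : ev T x = T ⟨x, h⟩ := by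
  simp [ev, h]

theorem ev_add {T : H →ₗ.[ℂ] H} {x y : H} (hx : x ∈ T.domain) (hy : y ∈ T.domain) :
    ev T (x + y) = ev T x + ev T y := by
  rw [ev_of_mem hx, ev_of_mem hy, ev_of_mem (add_mem hx hy), ← LinearPMap.map_add]
  rfl

theorem ev_smul {T : H →ₗ.[ℂ] H} {x : H} (a : ℂ) (hx : x ∈ T.domain) :
    ev T (a • x) = a • ev T x := by
  rw [ev_of_mem hx, ev_of_mem (T.domain.smul_mem a hx), ← LinearPMap.map_smul]
  rfl

theorem ev_sub {T : H →ₗ.[ℂ] H} {x y : H} (hx : x ∈ T.domain) (hy : y ∈ T.domain) :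
    ev T (x - y) = ev T x - ev T y := by
  rw [sub_eq_add_neg, ← neg_one_smul ℂ y, ev_add hx (T.domain.smul_mem _ hy), ev_smul _ hy]
  module

theorem inner_ev_left {T : H →ₗ.[ℂ] H} (hT : IsSelfAdjoint T) {x y : H} (hx : x ∈ T.domain)
    (hy : y ∈ T.domain) : ⟪ev T x, y⟫_ℂ = ⟪x, ev T y⟫_ℂ := by
  have h := LinearPMap.adjoint_isFormalAdjoint hT.dense_domain
  rw [LinearPMap.isSelfAdjoint_def.1 hT] at h
  rw [ev_of_mem hx, ev_of_mem hy]
  exact h ⟨x, hx⟩ ⟨y, hy⟩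

variable {T : H →ₗ.[ℂ] H}

theorem IsSelfAdjointGeOne.norm_le (hT : IsSelfAdjointGeOne T) (x : T.domain) :
    ‖(x : H)‖ ≤ ‖T x‖ := by
  by_cases h0 : ‖(x : H)‖ = 0
  · rw [h0]; exact norm_nonneg _
  have h1 := hT.one_le x
  have h2 := (Complex.re_le_norm _).trans (norm_inner_le_norm (𝕜 := ℂ) (x : H) (T x))
  have h3 : 0 < ‖(x : H)‖ := lt_of_le_of_ne (norm_nonneg _) (Ne.symm h0)
  nlinarith

/-- The bound `‖x‖ ≤ ‖T x‖` and closedness of the graph make the range closed. A vector orthogonal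
to the range lies in `ker T* = ker T`, which is trivial by the same bound. -/
theorem IsSelfAdjointGeOne.surjective (hT : IsSelfAdjointGeOne T) :
    Function.Surjective T := by
  have hclosed : IsClosed (LinearMap.range T.toFun : Set H) := by
    refine isClosed_of_closure_subset fun y hy => ?_
    obtain ⟨v, hv, hlim⟩ := mem_closure_iff_seq_limit.1 hy
    choose u hu using hv
    have hcau : CauchySeq fun n => (u n : H) := by
      have hc := hlim.cauchySeq
      rw [Metric.cauchySeq_iff] at hc ⊢
      intro ε hε
      obtain ⟨N, hN⟩ := hc ε hε
      refine ⟨N, fun m hm n hn => lt_of_le_of_lt ?_ (hN m hm n hn)⟩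
      rw [dist_eq_norm, dist_eq_norm, ← hu m, ← hu n, ← map_sub]
      exact hT.norm_le (u m - u n)
    obtain ⟨x, hx⟩ := cauchySeq_tendsto_of_complete hcau
    have hgr : (x, y) ∈ (T.graph : Set (H × H)) := by
      refine hT.isSelfAdjoint.isClosed.mem_of_tendsto (hx.prodMk_nhds hlim) ?_
      refine Eventually.of_forall fun n => ?_
      rw [← hu n]
      exact T.mem_graph (u n)
    obtain ⟨z, hz1, hz2⟩ := (LinearPMap.mem_graph_iff _).1 hgr
    exact ⟨z, hz2⟩
  have hperp : (LinearMap.range T.toFun)ᗮ = ⊥ := by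
    rw [Submodule.eq_bot_iff]
    intro y hy
    have hz : ∀ x : T.domain, ⟪(0 : H), x⟫_ℂ = ⟪y, T x⟫_ℂ := fun x => by
      rw [inner_zero_left]
      have := (Submodule.mem_orthogonal' _ _).1 hy (T x) ⟨x, rfl⟩
      exact this.symm
    have hmem := LinearPMap.mem_adjoint_domain_of_exists (T := T) y ⟨0, hz⟩
    have h0 := LinearPMap.adjoint_apply_eq hT.isSelfAdjoint.dense_domain ⟨y, hmem⟩ hz
    have hA := LinearPMap.isSelfAdjoint_def.1 hT.isSelfAdjoint
    have hgr : (y, (0 : H)) ∈ T.adjoint.graph := by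
      rw [LinearPMap.mem_graph_iff]
      exact ⟨⟨y, hmem⟩, rfl, h0⟩
    rw [hA, LinearPMap.mem_graph_iff] at hgr
    obtain ⟨z, hz1, hz2⟩ := hgr
    have := hT.norm_le z
    rw [hz2, norm_zero, hz1] at this
    exact norm_le_zero_iff.1 this
  have hc : (LinearMap.range T.toFun).topologicalClosure = ⊤ :=
    (Submodule.topologicalClosure_eq_top_iff).2 hperp
  rw [hclosed.submodule_topologicalClosure_eq] at hc
  intro y
  have : y ∈ LinearMap.range T.toFun := by rw [hc]; trivial
  obtain ⟨x, hx⟩ := this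
  exact ⟨x, hx⟩

theorem IsSelfAdjointGeOne.exists_isInverse (hT : IsSelfAdjointGeOne T) :
    ∃ R, IsInverse T R := by
  have hinj : Function.Injective T.toFun := by
    rw [injective_iff_map_eq_zero]
    intro x hx
    have := hT.norm_le x
    have hx' : T x = 0 := hx
    rw [hx', norm_zero] at this
    exact Subtype.ext (norm_le_zero_iff.1 this)
  let e : T.domain ≃ₗ[ℂ] H := LinearEquiv.ofBijective T.toFun ⟨hinj, hT.surjective⟩
  have he : ∀ x : T.domain, e x = T x := fun x => rfl
  let R : H →L[ℂ] H := LinearMap.mkContinuous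
    (T.domain.subtype ∘ₗ e.symm.toLinearMap) 1 (fun y => by
      have := hT.norm_le (e.symm y)
      rw [← he, e.apply_symm_apply] at this
      simpa using this)
  have hR : ∀ y, R y = (e.symm y : H) := fun y => rfl
  refine ⟨R, fun y => ⟨?_, ?_⟩, fun x => ?_⟩
  · rw [hR]; exact (e.symm y).2
  · have : T (e.symm y) = y := by rw [← he, e.apply_symm_apply]
    exact this
  · rw [hR, ← he, e.symm_apply_apply]

theorem IsSelfAdjointGeOne.isInverse_inv (hT : IsSelfAdjointGeOne T) : IsInverse T (inv T) := by
  rw [inv, dif_pos hT.exists_isInverse]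
  exact hT.exists_isInverse.choose_spec

theorem IsSelfAdjointGeOne.inv_nonneg (hT : IsSelfAdjointGeOne T) : 0 ≤ inv T := by
  rw [ContinuousLinearMap.nonneg_iff_isPositive, ContinuousLinearMap.isPositive_def']
  obtain ⟨h1, h2⟩ := hT.isInverse_inv
  refine ⟨?_, fun y => ?_⟩
  · rw [ContinuousLinearMap.isSelfAdjoint_iff_isSymmetric]
    intro x y
    obtain ⟨hx, ex⟩ := h1 x
    obtain ⟨hy, ey⟩ := h1 y
    have := inner_ev_left hT.isSelfAdjoint hx hy
    rw [ev_of_mem hx, ev_of_mem hy, ex, ey] at this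
    exact this.symm
  · obtain ⟨hy, ey⟩ := h1 y
    have := hT.one_le ⟨_, hy⟩
    rw [ey] at this
    exact (sq_nonneg _).trans this

theorem invSqrt_nonneg (T : H →ₗ.[ℂ] H) : 0 ≤ invSqrt T := CFC.sqrt_nonneg _

theorem IsSelfAdjointGeOne.invSqrt_invSqrt (hT : IsSelfAdjointGeOne T) (x : H) :
    invSqrt T (invSqrt T x) = inv T x := by
  have := CFC.sqrt_mul_sqrt_self (inv T) hT.inv_nonneg
  exact DFunLike.congr_fun this x

theorem IsSelfAdjointGeOne.invSqrt_injective (hT : IsSelfAdjointGeOne T) :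
    Function.Injective (invSqrt T) := by
  intro x y hxy
  have h : inv T x = inv T y := by
    rw [← hT.invSqrt_invSqrt, ← hT.invSqrt_invSqrt, hxy]
  obtain ⟨hx, ex⟩ := hT.isInverse_inv.1 x
  obtain ⟨hy, ey⟩ := hT.isInverse_inv.1 y
  rw [← ex, ← ey]
  congr 1
  exact Subtype.ext h

theorem mem_sqrtOp_domain (T : H →ₗ.[ℂ] H) (x : H) :
    x ∈ (sqrtOp T).domain ↔ x ∈ range (invSqrt T) := by
  rw [sqrtOp, LinearPMap.inverse_domain]
  constructor
  · rintro ⟨y, rfl⟩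
    exact ⟨y, rfl⟩
  · rintro ⟨y, rfl⟩
    exact ⟨⟨y, trivial⟩, rfl⟩

theorem IsSelfAdjointGeOne.ev_sqrtOp (hT : IsSelfAdjointGeOne T) (x : H) :
    ev (sqrtOp T) (invSqrt T x) = x := by
  have hm : invSqrt T x ∈ (sqrtOp T).domain := (mem_sqrtOp_domain T _).2 ⟨x, rfl⟩
  rw [ev_of_mem hm]
  have hker : LinearMap.ker
      (((invSqrt T : H →L[ℂ] H) : H →ₗ[ℂ] H).toPMap ⊤).toFun = ⊥ := by
    rw [LinearMap.ker_eq_bot]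
    intro a b hab
    exact Subtype.ext (hT.invSqrt_injective hab)
  exact LinearPMap.inverse_apply_eq hker (x := ⟨x, trivial⟩) rfl

theorem IsSelfAdjointGeOne.domain_le (hT : IsSelfAdjointGeOne T) :
    T.domain ≤ (sqrtOp T).domain := by
  intro x hx
  rw [mem_sqrtOp_domain]
  exact ⟨invSqrt T (T ⟨x, hx⟩), by rw [hT.invSqrt_invSqrt, hT.isInverse_inv.2 ⟨x, hx⟩]⟩

/-- On `dom T` the form of `T` is `‖T^{1/2} x‖²`. -/
theorem IsSelfAdjointGeOne.inner_ev (hT : IsSelfAdjointGeOne T) {x : H} (hx : x ∈ T.domain) :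
    ⟪x, ev T x⟫_ℂ = ((‖ev (sqrtOp T) x‖ ^ 2 : ℝ) : ℂ) := by
  have h1 : invSqrt T (invSqrt T (T ⟨x, hx⟩)) = x := by
    rw [hT.invSqrt_invSqrt, hT.isInverse_inv.2 ⟨x, hx⟩]
  rw [ev_of_mem hx]
  generalize T ⟨x, hx⟩ = y at h1 ⊢
  have hsa := ContinuousLinearMap.isSelfAdjoint_iff_isSymmetric.1
    (IsSelfAdjoint.of_nonneg (invSqrt_nonneg T))
  rw [← h1, hT.ev_sqrtOp]
  refine (hsa (invSqrt T y) y).trans ?_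
  push_cast
  exact inner_self_eq_norm_sq_to_K (𝕜 := ℂ) _

theorem exists_seq_of_hasCore {f : H →ₗ.[ℂ] H} {D : Submodule ℂ H} (h : f.HasCore D) {x : H}
    (hx : x ∈ f.domain) : ∃ u : ℕ → H, (∀ n, u n ∈ D) ∧ Tendsto u atTop (𝓝 x) ∧
      Tendsto (fun n => ev f (u n)) atTop (𝓝 (ev f x)) := by
  have hgr : (x, f ⟨x, hx⟩) ∈ closure ((f.domRestrict D).graph : Set (H × H)) := by
    -- The closure of a non-closable operator is by convention the operator itself; in that case the
    -- core condition says that the restriction to `D` already equals `f`.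
    by_cases hc : (f.domRestrict D).IsClosable
    · have := hc.graph_closure_eq_closure_graph
      rw [h.closure_eq] at this
      rw [← Submodule.topologicalClosure_coe, this]
      exact f.mem_graph ⟨x, hx⟩
    · have := LinearPMap.closure_def' hc
      rw [h.closure_eq] at this
      rw [← this]
      exact subset_closure (f.mem_graph ⟨x, hx⟩)
  obtain ⟨v, hv, hlim⟩ := mem_closure_iff_seq_limit.1 hgr
  have hv' : ∀ n, (v n).1 ∈ D ∧ (v n).2 = ev f (v n).1 := by
    intro n
    obtain ⟨z, hz1, hz2⟩ := (LinearPMap.mem_graph_iff _).1 (hv n)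
    have hzD : (z : H) ∈ D ∧ (z : H) ∈ f.domain := Submodule.mem_inf.1 z.2
    rw [← hz1, ← hz2]
    refine ⟨hzD.1, ?_⟩
    rw [ev_of_mem hzD.2]
    exact LinearPMap.domRestrict_apply rfl
  refine ⟨fun n => (v n).1, fun n => (hv' n).1, (continuous_fst.tendsto _).comp hlim, ?_⟩
  have h2 := (continuous_snd.tendsto _).comp hlim
  rw [ev_of_mem hx]
  refine h2.congr fun n => ?_
  exact (hv' n).2

theorem dense_of_hasCore {f : H →ₗ.[ℂ] H} {D : Submodule ℂ H} (h : f.HasCore D)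
    (hf : Dense (f.domain : Set H)) : Dense (D : Set H) := by
  have : (f.domain : Set H) ⊆ closure (D : Set H) := by
    intro x hx
    obtain ⟨u, hu, hlim, -⟩ := exists_seq_of_hasCore h hx
    exact mem_closure_of_tendsto hlim (Eventually.of_forall hu)
  exact dense_closure.1 (hf.mono this)

/-- A bounded operator whose form is dominated by that of `T` on a core of `T^{1/2}` is dominated
by it on `dom T^{1/2}`. -/
theorem le_form_of_core {D : Submodule ℂ H} (h : (sqrtOp T).HasCore D) {X : H →L[ℂ] H} {a : ℝ}
    (hX : ∀ ψ ∈ D, (⟪ψ, X ψ⟫_ℂ).re ≤ a * ‖ev (sqrtOp T) ψ‖ ^ 2) {ψ : H}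
    (hψ : ψ ∈ (sqrtOp T).domain) : (⟪ψ, X ψ⟫_ℂ).re ≤ a * ‖ev (sqrtOp T) ψ‖ ^ 2 := by
  obtain ⟨u, hu, h1, h2⟩ := exists_seq_of_hasCore h hψ
  have h3 : Tendsto (fun n => (⟪u n, X (u n)⟫_ℂ).re) atTop (𝓝 (⟪ψ, X ψ⟫_ℂ).re) := by
    have hc : Continuous fun v : H => (⟪v, X v⟫_ℂ).re := by fun_prop
    exact (hc.tendsto ψ).comp h1
  exact le_of_tendsto_of_tendsto' h3 ((h2.norm.pow 2).const_mul a) fun n => hX _ (hu n)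

end MME

namespace MME

set_option linter.unusedSectionVars false

open scoped ComplexOrder

variable {H : Type*} [NormedAddCommGroup H] [InnerProductSpace ℂ H] [CompleteSpace H]

/-! ### Bounded operators and forms -/

theorem inner_nonneg_of_nonneg {X : H →L[ℂ] H} (hX : 0 ≤ X) (x : H) : 0 ≤ ⟪x, X x⟫_ℂ :=
  ((ContinuousLinearMap.nonneg_iff_isPositive X).1 hX).inner_nonneg_right x

theorem inner_le_of_le {X Y : H →L[ℂ] H} (h : X ≤ Y) (x : H) : ⟪x, X x⟫_ℂ ≤ ⟪x, Y x⟫_ℂ := by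
  have := inner_nonneg_of_nonneg (sub_nonneg.2 h) x
  rw [sub_apply, inner_sub_right] at this
  exact sub_nonneg.1 this

/-- A bounded operator is positive as soon as its form is on a dense set. -/
theorem nonneg_of_dense {D : Set H} (hD : Dense D) {X : H →L[ℂ] H}
    (h : ∀ ψ ∈ D, 0 ≤ ⟪ψ, X ψ⟫_ℂ) : 0 ≤ X := by
  have hall : ∀ ψ, 0 ≤ ⟪ψ, X ψ⟫_ℂ := by
    have hcl : IsClosed {ψ : H | 0 ≤ ⟪ψ, X ψ⟫_ℂ} :=
      isClosed_le continuous_const (by fun_prop)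
    intro ψ
    exact hcl.closure_subset_iff.2 h (hD ψ)
  -- The order on `ℂ` makes `0 ≤ z` include `im z = 0`, so self-adjointness also comes from the
  -- form.
  rw [ContinuousLinearMap.nonneg_iff_isPositive, ContinuousLinearMap.isPositive_iff_complex]
  intro x
  have h1 := hall x
  rw [Complex.nonneg_iff] at h1
  rw [← inner_conj_symm (X x) x]
  refine ⟨?_, by simpa only [RCLike.re_to_complex, Complex.conj_re] using h1.1⟩
  apply Complex.ext
  · simp only [RCLike.re_to_complex, Complex.conj_re]; rfl
  · simp only [Complex.conj_im, ← h1.2, neg_zero]; exact Complex.ofReal_im _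

theorem le_of_dense {D : Set H} (hD : Dense D) {X Y : H →L[ℂ] H}
    (h : ∀ ψ ∈ D, ⟪ψ, X ψ⟫_ℂ ≤ ⟪ψ, Y ψ⟫_ℂ) : X ≤ Y := by
  rw [← sub_nonneg]
  refine nonneg_of_dense hD fun ψ hψ => ?_
  rw [sub_apply, inner_sub_right]
  exact sub_nonneg.2 (h ψ hψ)

theorem re_inner_nonneg {X : H →L[ℂ] H} (hX : 0 ≤ X) (x : H) : 0 ≤ (⟪x, X x⟫_ℂ).re :=
  (Complex.nonneg_iff.1 (inner_nonneg_of_nonneg hX x)).1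

theorem re_inner_le {X Y : H →L[ℂ] H} (h : X ≤ Y) (x : H) :
    (⟪x, X x⟫_ℂ).re ≤ (⟪x, Y x⟫_ℂ).re :=
  (Complex.le_def.1 (inner_le_of_le h x)).1

theorem ofReal_re_inner {X : H →L[ℂ] H} (hX : IsSelfAdjoint X) (x : H) :
    ((⟪x, X x⟫_ℂ).re : ℂ) = ⟪x, X x⟫_ℂ := by
  have h := ContinuousLinearMap.isSelfAdjoint_iff_isSymmetric.1 hX x x
  have h2 : (starRingEnd ℂ) ⟪x, X x⟫_ℂ = ⟪x, X x⟫_ℂ := by rw [inner_conj_symm]; exact h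
  exact Complex.conj_eq_iff_re.1 h2

/-- Polarization of `⟪x, X y⟫` in terms of the diagonal. -/
theorem inner_polarization (X : H →L[ℂ] H) (x y : H) :
    ⟪x, X y⟫_ℂ = (⟪x + y, X (x + y)⟫_ℂ - ⟪x - y, X (x - y)⟫_ℂ
      - Complex.I * ⟪x + Complex.I • y, X (x + Complex.I • y)⟫_ℂ
      + Complex.I * ⟪x - Complex.I • y, X (x - Complex.I • y)⟫_ℂ) / 4 := by
  simp only [map_add, map_sub, map_smul, inner_add_left, inner_add_right, inner_sub_left,
    inner_sub_right, inner_smul_left, inner_smul_right, Complex.conj_I]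
  ring_nf
  simp only [Complex.I_sq]
  ring

theorem eq_of_dense {D : Set H} (hD : Dense D) {X Y : H →L[ℂ] H}
    (h : ∀ ψ ∈ D, ⟪ψ, X ψ⟫_ℂ = ⟪ψ, Y ψ⟫_ℂ) : X = Y :=
  le_antisymm (le_of_dense hD fun ψ hψ => (h ψ hψ).le)
    (le_of_dense hD fun ψ hψ => (h ψ hψ).ge)

/-- A sesquilinear form on a dense subspace with bounded diagonal is the form of a bounded
operator. -/
theorem exists_op_of_form {D : Submodule ℂ H} (hD : Dense (D : Set H)) (q : H → H → ℂ)
    (add_left : ∀ φ ∈ D, ∀ φ' ∈ D, ∀ ψ ∈ D, q (φ + φ') ψ = q φ ψ + q φ' ψ)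
    (smul_left : ∀ a : ℂ, ∀ φ ∈ D, ∀ ψ ∈ D, q (a • φ) ψ = starRingEnd ℂ a * q φ ψ)
    (add_right : ∀ φ ∈ D, ∀ ψ ∈ D, ∀ ψ' ∈ D, q φ (ψ + ψ') = q φ ψ + q φ ψ')
    (smul_right : ∀ a : ℂ, ∀ φ ∈ D, ∀ ψ ∈ D, q φ (a • ψ) = a * q φ ψ)
    {C : ℝ} (hC0 : 0 ≤ C) (hC : ∀ ψ ∈ D, ‖q ψ ψ‖ ≤ C * ‖ψ‖ ^ 2) :
    ∃ T : H →L[ℂ] H, ‖T‖ ≤ 2 * C ∧ ∀ φ ∈ D, ∀ ψ ∈ D, ⟪φ, T ψ⟫_ℂ = q φ ψ := by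
  let Q : D →ₗ⋆[ℂ] D →ₗ[ℂ] ℂ := LinearMap.mk₂'ₛₗ (starRingEnd ℂ) (RingHom.id ℂ)
    (fun φ ψ => q φ ψ) (fun φ φ' ψ => add_left φ φ.2 φ' φ'.2 ψ ψ.2)
    (fun a φ ψ => smul_left a φ φ.2 ψ ψ.2) (fun φ ψ ψ' => add_right φ φ.2 ψ ψ.2 ψ' ψ'.2)
    (fun a φ ψ => smul_right a φ φ.2 ψ ψ.2)
  have hQC : ∀ ψ : D, ‖Q ψ ψ‖ ≤ C * ‖ψ‖ ^ 2 := fun ψ => hC ψ ψ.2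
  -- Polarization, followed by the parallelogram law to sum the four diagonal bounds.
  have hsum : ∀ φ ψ : D, ‖Q φ ψ‖ ≤ C * (‖φ‖ ^ 2 + ‖ψ‖ ^ 2) := by
    intro φ ψ
    have hpol : 4 * Q φ ψ = Q (φ + ψ) (φ + ψ) - Q (φ - ψ) (φ - ψ)
        - Complex.I * Q (φ + Complex.I • ψ) (φ + Complex.I • ψ)
        + Complex.I * Q (φ - Complex.I • ψ) (φ - Complex.I • ψ) := by
      simp only [map_add, map_sub, map_smul, LinearMap.map_smulₛₗ, LinearMap.add_apply,
        LinearMap.sub_apply, LinearMap.smul_apply, smul_eq_mul, Complex.conj_I]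
      ring_nf
      simp only [Complex.I_sq]
      ring
    have h1 := parallelogram_law_with_norm ℂ φ ψ
    have h2 := parallelogram_law_with_norm ℂ φ (Complex.I • ψ)
    rw [norm_smul, Complex.norm_I, one_mul] at h2
    have h3 : ‖4 * Q φ ψ‖ ≤ ‖Q (φ + ψ) (φ + ψ)‖ + ‖Q (φ - ψ) (φ - ψ)‖
        + ‖Q (φ + Complex.I • ψ) (φ + Complex.I • ψ)‖
        + ‖Q (φ - Complex.I • ψ) (φ - Complex.I • ψ)‖ := by
      rw [hpol]
      refine (norm_add_le _ _).trans (add_le_add ((norm_sub_le _ _).trans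
        (add_le_add (norm_sub_le _ _) ?_)) ?_) <;> simp
    have h4 : ‖4 * Q φ ψ‖ = 4 * ‖Q φ ψ‖ := by simp
    have g1 := hQC (φ + ψ)
    have g2 := hQC (φ - ψ)
    have g3 := hQC (φ + Complex.I • ψ)
    have g4 := hQC (φ - Complex.I • ψ)
    have : C * ‖φ + ψ‖ ^ 2 + C * ‖φ - ψ‖ ^ 2 + C * ‖φ + Complex.I • ψ‖ ^ 2
        + C * ‖φ - Complex.I • ψ‖ ^ 2 = 4 * (C * (‖φ‖ ^ 2 + ‖ψ‖ ^ 2)) := by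
      linear_combination C * h1 + C * h2
    linarith
  have hbd : ∀ φ ψ : D, ‖Q φ ψ‖ ≤ 2 * C * ‖φ‖ * ‖ψ‖ := by
    intro φ ψ
    by_cases h1 : φ = 0
    · simp [h1]
    by_cases h2 : ψ = 0
    · simp [h2]
    have p1 : 0 < ‖φ‖ := norm_pos_iff.2 h1
    have p2 : 0 < ‖ψ‖ := norm_pos_iff.2 h2
    -- Applied to unit vectors, the additive bound becomes a multiplicative one; `2 = 1 + 1` is the
    -- constant in `2 * C`.
    have h3 := hsum (((‖φ‖⁻¹ : ℝ) : ℂ) • φ) (((‖ψ‖⁻¹ : ℝ) : ℂ) • ψ)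
    rw [norm_smul, norm_smul] at h3
    simp only [LinearMap.map_smulₛₗ, LinearMap.smul_apply, smul_eq_mul, norm_mul,
      Complex.conj_ofReal,
      map_smul, Complex.norm_real, norm_inv, norm_norm, inv_mul_cancel₀ p1.ne',
      inv_mul_cancel₀ p2.ne'] at h3
    have h4 : ‖ψ‖⁻¹ * (‖φ‖⁻¹ * ‖Q φ ψ‖) = ‖Q φ ψ‖ / (‖φ‖ * ‖ψ‖) := by field_simp
    rw [h4, div_le_iff₀ (by positivity)] at h3
    linarith
  have hex : ∀ φ : D, ∃ v : H, ‖v‖ ≤ 2 * C * ‖φ‖ ∧ ∀ ψ : D, ⟪v, ψ⟫_ℂ = Q φ ψ := by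
    intro φ
    obtain ⟨g, hg1, hg2⟩ := exists_extension_norm_eq D
      ((Q φ).mkContinuous (2 * C * ‖φ‖) (hbd φ))
    refine ⟨(InnerProductSpace.toDual ℂ H).symm g, ?_, fun ψ => ?_⟩
    · rw [LinearIsometryEquiv.norm_map, hg2]
      exact LinearMap.mkContinuous_norm_le _ (by positivity) _
    · rw [InnerProductSpace.toDual_symm_apply, hg1]
      rfl
  choose v hv1 hv2 using hex
  have hvext : ∀ x y : H, (∀ ψ : D, ⟪x, ψ⟫_ℂ = ⟪y, ψ⟫_ℂ) → x = y := fun x y h =>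
    hD.eq_of_inner_left ℂ fun ψ hψ => h ⟨ψ, hψ⟩
  -- The Riesz vector represents `q` in its first argument, so `S` is the adjoint of the desired
  -- operator restricted to `D`; it is extended by density before the adjoint is taken.
  let S : D →ₗ[ℂ] H :=
    { toFun := v
      map_add' := fun φ φ' => hvext _ _ fun ψ => by
        rw [inner_add_left, hv2, hv2, hv2, map_add, LinearMap.add_apply]
      map_smul' := fun a φ => hvext _ _ fun ψ => by
        rw [RingHom.id_apply, inner_smul_left, hv2, hv2, LinearMap.map_smulₛₗ,
          LinearMap.smul_apply, smul_eq_mul] }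
  have hdr : DenseRange D.subtype := by
    rw [DenseRange, Submodule.coe_subtype, Subtype.range_coe]
    exact hD
  let S' : H →L[ℂ] H := S.extendOfNorm D.subtype
  have hS' : ∀ φ : D, S' φ = v φ := fun φ =>
    LinearMap.extendOfNorm_eq hdr ⟨2 * C, fun x => hv1 x⟩ φ
  refine ⟨ContinuousLinearMap.adjoint S', ?_, fun φ hφ ψ hψ => ?_⟩
  · rw [LinearIsometryEquiv.norm_map]
    exact S'.opNorm_le_bound (by positivity)
      (LinearMap.norm_extendOfNorm_apply_le hdr (2 * C) fun x => hv1 x)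
  rw [ContinuousLinearMap.adjoint_inner_right]
  have := hS' ⟨φ, hφ⟩
  rw [this]
  exact hv2 ⟨φ, hφ⟩ ⟨ψ, hψ⟩

theorem opOfForm_spec {D : Submodule ℂ H} {q : H → ℂ}
    (h : ∃ T : H →L[ℂ] H, ∀ ψ ∈ D, ⟪ψ, T ψ⟫_ℂ = q ψ) {ψ : H} (hψ : ψ ∈ D) :
    ⟪ψ, opOfForm D q ψ⟫_ℂ = q ψ := by
  rw [opOfForm, dif_pos h]
  exact h.choose_spec ψ hψ

/-- A bound on the diagonal of a form on a dense set bounds the norm of the operator. -/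
theorem norm_le_of_form {D : Set H} (hD : Dense D) {X : H →L[ℂ] H} {C : ℝ} (hC0 : 0 ≤ C)
    (hC : ∀ ψ ∈ D, ‖⟪ψ, X ψ⟫_ℂ‖ ≤ C * ‖ψ‖ ^ 2) : ‖X‖ ≤ 2 * C := by
  have hall : ∀ ψ, ‖⟪ψ, X ψ⟫_ℂ‖ ≤ C * ‖ψ‖ ^ 2 := by
    have hcl : IsClosed {ψ : H | ‖⟪ψ, X ψ⟫_ℂ‖ ≤ C * ‖ψ‖ ^ 2} :=
      isClosed_le (by fun_prop) (by fun_prop)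
    intro ψ
    exact hcl.closure_subset_iff.2 hC (hD ψ)
  obtain ⟨T, hT, hTq⟩ := exists_op_of_form (D := (⊤ : Submodule ℂ H)) (by simp)
    (fun φ ψ => ⟪φ, X ψ⟫_ℂ) (fun φ _ φ' _ ψ _ => inner_add_left _ _ _)
    (fun a φ _ ψ _ => inner_smul_left _ _ _)
    (fun φ _ ψ _ ψ' _ => by rw [map_add, inner_add_right])
    (fun a φ _ ψ _ => by rw [map_smul, inner_smul_right]) hC0 fun ψ _ => hall ψ
  rwa [eq_of_dense dense_univ fun ψ _ => hTq ψ trivial ψ trivial] at hT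

/-- An increasing bounded sequence of positive operators has a least upper bound, which is also
its weak limit. -/
theorem exists_isLUB_of_monotone {X : ℕ → H →L[ℂ] H} (hmono : Monotone X) (h0 : ∀ n, 0 ≤ X n)
    {C : ℝ} (hC0 : 0 ≤ C) (hC : ∀ n ψ, (⟪ψ, X n ψ⟫_ℂ).re ≤ C * ‖ψ‖ ^ 2) :
    ∃ T, IsLUB (range X) T ∧ ∀ ψ, Tendsto (fun n => ⟪ψ, X n ψ⟫_ℂ) atTop (𝓝 ⟪ψ, T ψ⟫_ℂ) := by
  have hdiag : ∀ ψ, ∃ l, Tendsto (fun n => ⟪ψ, X n ψ⟫_ℂ) atTop (𝓝 l) := by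
    intro ψ
    have hm : Monotone fun n => (⟪ψ, X n ψ⟫_ℂ).re := fun m n hmn => re_inner_le (hmono hmn) ψ
    have hb : BddAbove (range fun n => (⟪ψ, X n ψ⟫_ℂ).re) :=
      ⟨C * ‖ψ‖ ^ 2, by rintro _ ⟨n, rfl⟩; exact hC n ψ⟩
    refine ⟨_, ((Complex.continuous_ofReal.tendsto _).comp (tendsto_atTop_ciSup hm hb)).congr ?_⟩
    exact fun n => ofReal_re_inner (IsSelfAdjoint.of_nonneg (h0 n)) ψ
  have hex : ∀ φ ψ, ∃ l, Tendsto (fun n => ⟪φ, X n ψ⟫_ℂ) atTop (𝓝 l) := by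
    intro φ ψ
    obtain ⟨l1, h1⟩ := hdiag (φ + ψ)
    obtain ⟨l2, h2⟩ := hdiag (φ - ψ)
    obtain ⟨l3, h3⟩ := hdiag (φ + Complex.I • ψ)
    obtain ⟨l4, h4⟩ := hdiag (φ - Complex.I • ψ)
    exact ⟨_, ((((h1.sub h2).sub (h3.const_mul _)).add (h4.const_mul _)).div_const 4).congr
      fun n => (inner_polarization (X n) φ ψ).symm⟩
  choose q hq using hex
  obtain ⟨T, -, hT⟩ := exists_op_of_form (D := (⊤ : Submodule ℂ H)) (by simp) q
    (fun φ _ φ' _ ψ _ => tendsto_nhds_unique (hq _ _)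
      (((hq φ ψ).add (hq φ' ψ)).congr fun n => by rw [inner_add_left]))
    (fun a φ _ ψ _ => tendsto_nhds_unique (hq _ _)
      (((hq φ ψ).const_mul _).congr fun n => by rw [inner_smul_left]))
    (fun φ _ ψ _ ψ' _ => tendsto_nhds_unique (hq _ _)
      (((hq φ ψ).add (hq φ ψ')).congr fun n => by rw [map_add, inner_add_right]))
    (fun a φ _ ψ _ => tendsto_nhds_unique (hq _ _)
      (((hq φ ψ).const_mul _).congr fun n => by rw [map_smul, inner_smul_right]))
    hC0 (fun ψ _ => le_of_tendsto (hq ψ ψ).norm (Eventually.of_forall fun n => by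
      rw [← ofReal_re_inner (IsSelfAdjoint.of_nonneg (h0 n)) ψ, Complex.norm_real,
        Real.norm_of_nonneg (re_inner_nonneg (h0 n) ψ)]
      exact hC n ψ))
  have hlim : ∀ ψ, Tendsto (fun n => ⟪ψ, X n ψ⟫_ℂ) atTop (𝓝 ⟪ψ, T ψ⟫_ℂ) := fun ψ => by
    rw [hT ψ trivial ψ trivial]
    exact hq ψ ψ
  refine ⟨T, ⟨?_, fun Y hY => ?_⟩, hlim⟩
  · rintro _ ⟨n, rfl⟩
    refine le_of_dense dense_univ fun ψ _ => ge_of_tendsto (hlim ψ) ?_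
    filter_upwards [eventually_ge_atTop n] with m hm
    exact inner_le_of_le (hmono hm) ψ
  · refine le_of_dense dense_univ fun ψ _ => le_of_tendsto (hlim ψ) (Eventually.of_forall ?_)
    exact fun n => inner_le_of_le (hY ⟨n, rfl⟩) ψ

end MME

namespace MME

set_option linter.unusedSectionVars false

open scoped ComplexOrder ComplexStarModule

variable {H : Type*} [NormedAddCommGroup H] [InnerProductSpace ℂ H] [CompleteSpace H]

/-! ### Completely positive maps -/

theorem cp_mono (A : (H →L[ℂ] H) →CP (H →L[ℂ] H)) {X Y : H →L[ℂ] H} (h : X ≤ Y) : A X ≤ A Y :=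
  OrderHomClass.mono A h

theorem cp_nonneg (A : (H →L[ℂ] H) →CP (H →L[ℂ] H)) {X : H →L[ℂ] H} (h : 0 ≤ X) : 0 ≤ A X := by
  simpa using cp_mono A h

/-- Positivity of `A` is applied to `-‖X‖ ≤ X ≤ ‖X‖`. -/
theorem abs_re_inner_cp_le (A : (H →L[ℂ] H) →CP (H →L[ℂ] H)) {X : H →L[ℂ] H}
    (hX : IsSelfAdjoint X) (u : H) : |(⟪u, A X u⟫_ℂ).re| ≤ ‖X‖ * (⟪u, A 1 u⟫_ℂ).re := by
  have e : (algebraMap ℝ (H →L[ℂ] H)) ‖X‖ = ((‖X‖ : ℝ) : ℂ) • (1 : H →L[ℂ] H) := by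
    rw [Algebra.algebraMap_eq_smul_one]; rfl
  have h1 := re_inner_le (cp_mono A (IsSelfAdjoint.le_algebraMap_norm_self hX)) u
  have h2 := re_inner_le (cp_mono A (IsSelfAdjoint.neg_algebraMap_norm_le_self hX)) u
  rw [e, map_smul, smul_apply, inner_smul_right, Complex.re_ofReal_mul] at h1
  rw [e, map_neg, map_smul, neg_apply, smul_apply,
    inner_neg_right, inner_smul_right, Complex.neg_re, Complex.re_ofReal_mul] at h2
  exact abs_le.2 ⟨h2, h1⟩

/-- The factor `2` comes from splitting `X` into real and imaginary parts, each of norm at most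
`‖X‖`. It is harmless, since uniform bounds in `n` are obtained later by order arguments. -/
theorem norm_inner_cp_le (A : (H →L[ℂ] H) →CP (H →L[ℂ] H)) (X : H →L[ℂ] H) (u : H) :
    ‖⟪u, A X u⟫_ℂ‖ ≤ 2 * ‖X‖ * (⟪u, A 1 u⟫_ℂ).re := by
  have hsa : ∀ {Y : H →L[ℂ] H}, IsSelfAdjoint Y → IsSelfAdjoint (A Y) := fun {Y} hY => by
    have h3 := sub_nonneg.2 (cp_mono A (IsSelfAdjoint.le_algebraMap_norm_self hY))
    have h4 : 0 ≤ (algebraMap ℝ (H →L[ℂ] H)) ‖Y‖ := by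
      rw [Algebra.algebraMap_eq_smul_one]; exact smul_nonneg (norm_nonneg _) zero_le_one
    have := (IsSelfAdjoint.of_nonneg (cp_nonneg A h4)).sub (IsSelfAdjoint.of_nonneg h3)
    simpa using this
  have hb : ∀ {Y : H →L[ℂ] H}, IsSelfAdjoint Y → ‖Y‖ ≤ ‖X‖ →
      ‖⟪u, A Y u⟫_ℂ‖ ≤ ‖X‖ * (⟪u, A 1 u⟫_ℂ).re := fun {Y} hY hle => by
    rw [← ofReal_re_inner (hsa hY) u, Complex.norm_real, Real.norm_eq_abs]
    exact (abs_re_inner_cp_le A hY u).trans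
      (mul_le_mul_of_nonneg_right hle (re_inner_nonneg (cp_nonneg A zero_le_one) u))
  have hdec := realPart_add_I_smul_imaginaryPart X
  have h1 := hb (ℜ X).2 (realPart.norm_le X)
  have h2 := hb (ℑ X).2 (imaginaryPart.norm_le X)
  conv_lhs => rw [← hdec]
  rw [map_add, map_smul, add_apply, smul_apply,
    inner_add_right, inner_smul_right]
  refine (norm_add_le _ _).trans ?_
  rw [norm_mul, Complex.norm_I, one_mul]
  linarith

/-! ### Weak measurability -/

/-- Measurability of an operator valued function in the weak operator topology. -/
def WeaklyMeasurable (Y : ℝ → H →L[ℂ] H) : Prop :=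
  ∀ x y, Measurable fun s => ⟪x, Y s y⟫_ℂ

theorem weaklyMeasurable_const (X : H →L[ℂ] H) : WeaklyMeasurable fun _ => X :=
  fun _ _ => measurable_const

theorem weaklyMeasurable_of_dense {D : Set H} (hD : Dense D) {Y : ℝ → H →L[ℂ] H}
    (h : ∀ ψ ∈ D, Measurable fun s => ⟪ψ, Y s ψ⟫_ℂ) : WeaklyMeasurable Y := by
  have hdiag : ∀ x, Measurable fun s => ⟪x, Y s x⟫_ℂ := by
    intro x
    obtain ⟨u, hu, hlim⟩ := mem_closure_iff_seq_limit.1 (hD x)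
    refine measurable_of_tendsto_metrizable (fun n => h (u n) (hu n)) ?_
    rw [tendsto_pi_nhds]
    intro s
    have hc : Continuous fun v : H => ⟪v, Y s v⟫_ℂ := by fun_prop
    exact (hc.tendsto x).comp hlim
  intro x y
  simp_rw [fun s => inner_polarization (Y s) x y]
  exact ((((hdiag _).sub (hdiag _)).sub ((hdiag _).const_mul _)).add
    ((hdiag _).const_mul _)).div_const 4

/-- The functional `X ↦ ⟪u, X v⟫`. -/
def vectorFunctional (u v : H) : (H →L[ℂ] H) →ₗ[ℂ] ℂ where
  toFun X := ⟪u, X v⟫_ℂ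
  map_add' X Y := by rw [add_apply, inner_add_right]
  map_smul' a X := by rw [smul_apply, inner_smul_right]; rfl

theorem isUltraweak_vectorFunctional (u v : H) : IsUltraweak (vectorFunctional u v) := by
  refine ⟨fun n => if n = 0 then u else 0, fun n => if n = 0 then v else 0, ?_, ?_, fun X => ?_⟩
  · exact summable_of_ne_finset_zero (s := {0}) fun n hn => by
      simp [Finset.mem_singleton.not.1 hn]
  · exact summable_of_ne_finset_zero (s := {0}) fun n hn => by
      simp [Finset.mem_singleton.not.1 hn]
  · have := hasSum_single (f := fun n : ℕ => ⟪if n = 0 then u else 0, X (if n = 0 then v else 0)⟫_ℂ)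
      0 (fun n hn => by simp [hn])
    simpa [vectorFunctional] using this

theorem WeaklyMeasurable.ultraweak {Y : ℝ → H →L[ℂ] H} (hY : WeaklyMeasurable Y)
    {ω : (H →L[ℂ] H) →ₗ[ℂ] ℂ} (hω : IsUltraweak ω) : Measurable fun s => ω (Y s) := by
  obtain ⟨x, y, -, -, h⟩ := hω
  refine measurable_of_tendsto_metrizable
    (f := fun N s => ∑ n ∈ Finset.range N, ⟪x n, Y s (y n)⟫_ℂ)
    (fun N => Finset.measurable_sum _ fun n _ => hY (x n) (y n)) ?_
  rw [tendsto_pi_nhds]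
  exact fun s => (h (Y s)).tendsto_sum_nat

/-- The integrand is continuous in the vector and measurable in time, hence jointly measurable on
the separable space `H`. -/
theorem WeaklyMeasurable.inner_self [TopologicalSpace.SeparableSpace H] [MeasurableSpace H]
    [BorelSpace H] {Y : ℝ → H →L[ℂ] H} (hY : WeaklyMeasurable Y) :
    Measurable fun p : H × ℝ => ⟪p.1, Y p.2 p.1⟫_ℂ := by
  have : SecondCountableTopology H := UniformSpace.secondCountable_of_separable H
  refine measurable_uncurry_of_continuous_of_measurable (u := fun (v : H) s => ⟪v, Y s v⟫_ℂ)
    (fun s => ?_) (fun v => hY v v)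
  fun_prop

end MME

/-! ### Measurability of the forms `Φₛ(Yₛ)` along the evolution -/

namespace MarkovMasterEquation

open MME

variable {H : Type*} [NormedAddCommGroup H] [InnerProductSpace ℂ H] [CompleteSpace H]
  {M : MarkovMasterEquation H}

/-- The times in `A` and in `Y` are separated. Ultraweak continuity of `s ↦ Aₛ(X)` gives continuity
in the first; normality of each `Aₛ` turns weak measurability of `Y` into measurability in the
second. Restricting to the diagonal ends the proof; `max 0 s` extends the family to negative times.
-/
theorem weaklyMeasurable_A (hM : M.DomainContinuity) {Y : ℝ → H →L[ℂ] H}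
    (hY : WeaklyMeasurable Y) : WeaklyMeasurable fun s => M.A (max 0 s) (Y s) := by
  intro x y
  have hu := isUltraweak_vectorFunctional x y
  suffices h : Measurable (Function.uncurry fun s r : ℝ =>
      vectorFunctional x y (M.A (max 0 s) (Y r))) from
    h.comp (measurable_id.prodMk measurable_id)
  refine measurable_uncurry_of_continuous_of_measurable (fun r => ?_) (fun s => ?_)
  · exact (hM.ultraweak_continuous (Y r) _ hu).comp_continuous (by fun_prop)
      fun s => le_max_left 0 s
  · exact hY.ultraweak (hM.normal _ (le_max_left 0 s) _ hu)

/-- `Λ^{-1/2}` is continuous and injective on a Polish space, hence a measurable embedding by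
Lusin–Souslin, and `M.sq` is its inverse extended by `0`. -/
theorem measurable_sq [TopologicalSpace.SeparableSpace H] [MeasurableSpace H] [BorelSpace H]
    (hM : M.DomainContinuity) : Measurable M.sq := by
  have : SecondCountableTopology H := UniformSpace.secondCountable_of_separable H
  have hemb := (invSqrt M.Λ).continuous.measurableEmbedding hM.Λ_ge.invSqrt_injective
  have hext : M.sq = Function.extend (invSqrt M.Λ) id fun _ => 0 := by
    funext x
    by_cases hx : x ∈ range (invSqrt M.Λ)
    · obtain ⟨y, rfl⟩ := hx
      rw [hM.Λ_ge.invSqrt_injective.extend_apply, sq, hM.Λ_ge.ev_sqrtOp, id]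
    · rw [Function.extend_apply' _ _ _ hx, sq, ev,
        dif_neg fun h => hx ((mem_sqrtOp_domain _ _).1 h)]
  rw [hext]
  exact hemb.measurable_extend measurable_id measurable_const

/-- Joint measurability of `Φₛ(Yₛ)[W s t ψ]` in `(s, t)`. -/
theorem measurable_phi [TopologicalSpace.SeparableSpace H]
    (hM : M.DomainContinuity) {Y : ℝ → H →L[ℂ] H} (hY : WeaklyMeasurable Y) (ψ : H) :
    Measurable fun p : ℝ × ℝ => M.phi (max 0 p.1) (Y p.1)
      (M.W (max 0 p.1) (max (max 0 p.1) p.2) ψ) (M.W (max 0 p.1) (max (max 0 p.1) p.2) ψ) := by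
  borelize H
  have h1 : Continuous fun p : ℝ × ℝ => M.W (max 0 p.1) (max (max 0 p.1) p.2) ψ :=
    (hM.evolution.continuousOn ψ).comp_continuous
      (f := fun p : ℝ × ℝ => (max 0 p.1, max (max 0 p.1) p.2)) (by fun_prop)
      fun p => ⟨le_max_left _ _, le_max_left _ _⟩
  exact (weaklyMeasurable_A hM hY).inner_self.comp
    (((measurable_sq hM).comp h1.measurable).prodMk measurable_fst)

end MarkovMasterEquation

namespace MarkovMasterEquation

open MME

set_option linter.unusedSectionVars false

variable {H : Type*} [NormedAddCommGroup H] [InnerProductSpace ℂ H] [CompleteSpace H]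
  {M : MarkovMasterEquation H}

/-! ### The forms `Φₛ(X)` along the evolution -/

theorem phi_add_left (s : ℝ) (X : H →L[ℂ] H) {φ φ' : H} (ψ : H)
    (h : φ ∈ (sqrtOp M.Λ).domain) (h' : φ' ∈ (sqrtOp M.Λ).domain) :
    M.phi s X (φ + φ') ψ = M.phi s X φ ψ + M.phi s X φ' ψ := by
  rw [phi, sq, ev_add h h', inner_add_left]; rfl

theorem phi_add_right (s : ℝ) (X : H →L[ℂ] H) (φ : H) {ψ ψ' : H}
    (h : ψ ∈ (sqrtOp M.Λ).domain) (h' : ψ' ∈ (sqrtOp M.Λ).domain) :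
    M.phi s X φ (ψ + ψ') = M.phi s X φ ψ + M.phi s X φ ψ' := by
  simp only [phi, sq]
  rw [ev_add h h', map_add, inner_add_right]

theorem phi_smul_left (s : ℝ) (X : H →L[ℂ] H) (a : ℂ) {φ : H} (ψ : H)
    (h : φ ∈ (sqrtOp M.Λ).domain) :
    M.phi s X (a • φ) ψ = starRingEnd ℂ a * M.phi s X φ ψ := by
  rw [phi, sq, ev_smul _ h, inner_smul_left]; rfl

theorem phi_smul_right (s : ℝ) (X : H →L[ℂ] H) (a : ℂ) (φ : H) {ψ : H}
    (h : ψ ∈ (sqrtOp M.Λ).domain) :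
    M.phi s X φ (a • ψ) = a * M.phi s X φ ψ := by
  simp only [phi, sq]
  rw [ev_smul _ h, map_smul, inner_smul_right]

theorem phi_polarization (s : ℝ) (X : H →L[ℂ] H) {φ ψ : H}
    (h : φ ∈ (sqrtOp M.Λ).domain) (h' : ψ ∈ (sqrtOp M.Λ).domain) :
    M.phi s X φ ψ = (M.phi s X (φ + ψ) (φ + ψ) - M.phi s X (φ - ψ) (φ - ψ)
      - Complex.I * M.phi s X (φ + Complex.I • ψ) (φ + Complex.I • ψ)
      + Complex.I * M.phi s X (φ - Complex.I • ψ) (φ - Complex.I • ψ)) / 4 := by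
  have hI := (sqrtOp M.Λ).domain.smul_mem Complex.I h'
  simp only [phi, sq]
  rw [ev_add h h', ev_sub h h', ev_add h hI, ev_sub h hI, ev_smul _ h']
  exact inner_polarization _ _ _

theorem phi_one_re_nonneg (s : ℝ) (ψ : H) : 0 ≤ (M.phi s 1 ψ ψ).re :=
  re_inner_nonneg (cp_nonneg _ zero_le_one) _

theorem norm_phi_le (s : ℝ) (X : H →L[ℂ] H) (ψ : H) :
    ‖M.phi s X ψ ψ‖ ≤ 2 * ‖X‖ * (M.phi s 1 ψ ψ).re :=
  norm_inner_cp_le _ _ _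

theorem inner_P_zero (τ t : ℝ) (B : H →L[ℂ] H) (x y : H) :
    ⟪x, M.P 0 τ t B y⟫_ℂ = ⟪M.W τ t x, B (M.W τ t y)⟫_ℂ := by
  rw [P, mul_apply_eq_comp, mul_apply_eq_comp,
    ContinuousLinearMap.star_eq_adjoint, ContinuousLinearMap.adjoint_inner_right]

theorem W_mem (hM : M.DomainContinuity)
    {s t : ℝ} (hs : 0 ≤ s) (hst : s ≤ t) {ψ : H} (hψ : ψ ∈ M.D) : M.W s t ψ ∈ M.D :=
  hM.evolution.maps_core s t hs hst ψ hψ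

theorem W_mem_dom (hM : M.DomainContinuity)
    {s t : ℝ} (hs : 0 ≤ s) (hst : s ≤ t) {ψ : H} (hψ : ψ ∈ M.D) :
    M.W s t ψ ∈ (sqrtOp M.Λ).domain :=
  hM.D_le (W_mem hM hs hst hψ)

theorem norm_W_le (hM : M.DomainContinuity)
    {s t : ℝ} (hs : 0 ≤ s) (hst : s ≤ t) (ψ : H) : ‖M.W s t ψ‖ ≤ ‖ψ‖ := by
  simpa using (M.W s t).le_of_opNorm_le (hM.evolution.norm_le s t hs hst) ψ

theorem dense_D (hM : M.DomainContinuity) : Dense (M.D : Set H) :=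
  dense_of_hasCore (hM.core 0 le_rfl) (hM.G_dense 0 le_rfl)

/-- Since `Φₛ(I) ≤ Λ`, the integrand is dominated by `2K ‖Λ^{1/2} W s t ψ‖²`, integrable by the
square integrability condition. -/
theorem intervalIntegrable_phi (hM : M.DomainContinuity)
    [TopologicalSpace.SeparableSpace H] {τ t : ℝ} (hτ : 0 ≤ τ)
    (hτt : τ ≤ t) {Y : ℝ → H →L[ℂ] H} (hY : WeaklyMeasurable Y) {K : ℝ}
    (hK : ∀ s ∈ Icc τ t, ‖Y s‖ ≤ K) {ψ : H} (hψ : ψ ∈ M.D) :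
    IntervalIntegrable (fun s => M.phi s (Y s) (M.W s t ψ) (M.W s t ψ)) volume τ t := by
  rw [intervalIntegrable_iff_integrableOn_Ioc_of_le hτt]
  have hsub : Ioc τ t ⊆ Icc 0 t := fun s hs => ⟨hτ.trans hs.1.le, hs.2⟩
  have hint0 : IntegrableOn (fun s => ‖M.sq (M.W s t ψ)‖ ^ 2) (Icc 0 t) :=
    (hM.sq_memLp ψ hψ t (hτ.trans hτt)).integrable_norm_pow two_ne_zero
  have hint : IntegrableOn (fun s => 2 * K * ‖M.sq (M.W s t ψ)‖ ^ 2) (Ioc τ t) :=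
    Integrable.const_mul (hint0.mono_set hsub) _
  refine Integrable.mono' hint ?_ ?_
  · have hm : Measurable fun s => M.phi (max 0 s) (Y s) (M.W (max 0 s) (max (max 0 s) t) ψ)
        (M.W (max 0 s) (max (max 0 s) t) ψ) :=
      (measurable_phi hM hY ψ).comp (measurable_id.prodMk measurable_const)
    refine hm.aestronglyMeasurable.congr ?_
    filter_upwards [ae_restrict_mem measurableSet_Ioc] with s hs
    have h0 := hsub hs
    rw [max_eq_right h0.1, max_eq_right h0.2]
  · filter_upwards [ae_restrict_mem measurableSet_Ioc] with s hs
    have h0 := hsub hs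
    refine (norm_phi_le s _ _).trans ?_
    have h1 := hM.phi_one_le s h0.1 _ (W_mem_dom hM h0.1 h0.2 hψ)
    have h2 := hK s ⟨hs.1.le, hs.2⟩
    have h3 := (norm_nonneg _).trans h2
    have h4 := phi_one_re_nonneg (M := M) s (M.W s t ψ)
    gcongr

theorem continuousOn_W_left (hM : M.DomainContinuity) {t : ℝ} (ψ : H) :
    ContinuousOn (fun s => M.W s t ψ) (Icc 0 t) :=
  (hM.evolution.continuousOn ψ).comp (f := fun s => (s, t)) (by fun_prop) fun s hs => hs

theorem hasDerivWithinAt_W (hM : M.DomainContinuity)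
    {s t : ℝ} (hs : 0 ≤ s) (hst : s < t) {ψ : H} (hψ : ψ ∈ M.D) :
    HasDerivWithinAt (fun r => M.W r t ψ) (ev (M.G s) (M.W s t ψ)) (Ioi s) s := by
  refine (hM.evolution.deriv_left s t hs hst.le ψ hψ).mono_of_mem_nhdsWithin ?_
  filter_upwards [Ioc_mem_nhdsGT hst] with r hr using ⟨hs.trans hr.1.le, hr.2⟩

/-- The energy balance `∫ Φₛ(I)[W s t ψ] ds = ‖ψ‖² - ‖W τ t ψ‖²`. -/
theorem integral_phi_one (hM : M.DomainContinuity)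
    [TopologicalSpace.SeparableSpace H] {τ t : ℝ} (hτ : 0 ≤ τ)
    (hτt : τ ≤ t) {ψ : H} (hψ : ψ ∈ M.D) :
    ∫ s in τ..t, M.phi s 1 (M.W s t ψ) (M.W s t ψ) =
      ⟪ψ, ψ⟫_ℂ - ⟪M.W τ t ψ, M.W τ t ψ⟫_ℂ := by
  have hc : ContinuousOn (fun s => M.W s t ψ) (Icc τ t) :=
    (continuousOn_W_left hM ψ).mono (Icc_subset_Icc hτ le_rfl)
  rw [intervalIntegral.integral_eq_sub_of_hasDeriv_right_of_le
    (f := fun s => ⟪M.W s t ψ, M.W s t ψ⟫_ℂ) hτt (hc.inner (𝕜 := ℂ) hc) (fun s hs => ?_)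
    (intervalIntegrable_phi hM hτ hτt (weaklyMeasurable_const 1) (K := ‖(1 : H →L[ℂ] H)‖)
      (fun _ _ => le_rfl) hψ)]
  · simp [hM.evolution.refl t (hτ.trans hτt)]
  · have h0 := hτ.trans hs.1.le
    have hd := hasDerivWithinAt_W hM h0 hs.2 hψ
    have hW := W_mem hM h0 hs.2.le hψ
    -- The derivative of `‖W s t ψ‖²` is the form of `Gₛ* + Gₛ = Φₛ(I)` at `W s t ψ`.
    have := hd.inner ℂ hd
    rw [add_comm, hM.G_add_adjoint s h0 _ hW _ hW] at this
    exact this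

theorem integral_phi_one_re (hM : M.DomainContinuity)
    [TopologicalSpace.SeparableSpace H] {τ t : ℝ} (hτ : 0 ≤ τ)
    (hτt : τ ≤ t) {ψ : H} (hψ : ψ ∈ M.D) :
    IntervalIntegrable (fun s => (M.phi s 1 (M.W s t ψ) (M.W s t ψ)).re) volume τ t ∧
    ∫ s in τ..t, (M.phi s 1 (M.W s t ψ) (M.W s t ψ)).re = ‖ψ‖ ^ 2 - ‖M.W τ t ψ‖ ^ 2 := by
  have hi := intervalIntegrable_phi hM hτ hτt (weaklyMeasurable_const 1)
    (K := ‖(1 : H →L[ℂ] H)‖) (fun _ _ => le_rfl) hψ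
  refine ⟨?_, ?_⟩
  · rw [intervalIntegrable_iff] at hi ⊢
    exact hi.re
  · have h := integral_phi_one hM hτ hτt hψ
    have h2 := Complex.reCLM.intervalIntegral_comp_comm hi
    rw [h] at h2
    simp only [Complex.reCLM_apply] at h2
    rw [h2, Complex.sub_re]
    congr 1
    · exact (norm_sq_eq_re_inner (𝕜 := ℂ) ψ).symm
    · exact (norm_sq_eq_re_inner (𝕜 := ℂ) _).symm

/-! ### The successive approximations -/

/-- The energy balance bounds the integral by `‖ψ‖²` instead of an unbounded form of `ψ`; this is
why the next approximation is a bounded operator. -/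
theorem norm_integral_phi_le (hM : M.DomainContinuity)
    [TopologicalSpace.SeparableSpace H] {τ t : ℝ} (hτ : 0 ≤ τ)
    (hτt : τ ≤ t) {Y : ℝ → H →L[ℂ] H} {K : ℝ} (hK0 : 0 ≤ K)
    (hK : ∀ s ∈ Icc τ t, ‖Y s‖ ≤ K) {ψ : H} (hψ : ψ ∈ M.D) :
    ‖∫ s in τ..t, M.phi s (Y s) (M.W s t ψ) (M.W s t ψ)‖ ≤ 2 * K * ‖ψ‖ ^ 2 := by
  obtain ⟨hi, he⟩ := integral_phi_one_re hM hτ hτt hψ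
  calc ‖∫ s in τ..t, M.phi s (Y s) (M.W s t ψ) (M.W s t ψ)‖
      ≤ ∫ s in τ..t, 2 * K * (M.phi s 1 (M.W s t ψ) (M.W s t ψ)).re := by
        refine intervalIntegral.norm_integral_le_of_norm_le hτt ?_ (hi.const_mul _)
        refine Eventually.of_forall fun s hs => (norm_phi_le s _ _).trans ?_
        exact mul_le_mul_of_nonneg_right (by linarith [hK s ⟨hs.1.le, hs.2⟩])
          (phi_one_re_nonneg s _)
    _ ≤ 2 * K * ‖ψ‖ ^ 2 := by
        rw [intervalIntegral.integral_const_mul, he]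
        exact mul_le_mul_of_nonneg_left (by linarith [sq_nonneg ‖M.W τ t ψ‖]) (by positivity)

/-- The bound on the form defining the next approximation. -/
theorem norm_form_le (hM : M.DomainContinuity)
    [TopologicalSpace.SeparableSpace H] {τ t : ℝ} (hτ : 0 ≤ τ)
    (hτt : τ ≤ t) (B : H →L[ℂ] H) {Y : ℝ → H →L[ℂ] H} {K : ℝ} (hK0 : 0 ≤ K)
    (hK : ∀ s ∈ Icc τ t, ‖Y s‖ ≤ K) {ψ : H} (hψ : ψ ∈ M.D) :
    ‖⟪M.W τ t ψ, B (M.W τ t ψ)⟫_ℂ + ∫ s in τ..t, M.phi s (Y s) (M.W s t ψ) (M.W s t ψ)‖ ≤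
      (‖B‖ + 2 * K) * ‖ψ‖ ^ 2 := by
  refine (norm_add_le _ _).trans ?_
  have h1 := norm_integral_phi_le hM hτ hτt hK0 hK hψ
  have h2 : ‖⟪M.W τ t ψ, B (M.W τ t ψ)⟫_ℂ‖ ≤ ‖B‖ * ‖ψ‖ ^ 2 := by
    refine (norm_inner_le_norm _ _).trans ?_
    have hw := norm_W_le hM hτ hτt ψ
    calc ‖M.W τ t ψ‖ * ‖B (M.W τ t ψ)‖ ≤ ‖M.W τ t ψ‖ * (‖B‖ * ‖M.W τ t ψ‖) := by
          gcongr; exact B.le_opNorm _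
      _ ≤ ‖ψ‖ * (‖B‖ * ‖ψ‖) := by gcongr
      _ = ‖B‖ * ‖ψ‖ ^ 2 := by ring
  linarith

theorem exists_op_next (hM : M.DomainContinuity)
    [TopologicalSpace.SeparableSpace H] {τ t : ℝ} (hτ : 0 ≤ τ)
    (hτt : τ ≤ t) (B : H →L[ℂ] H) {Y : ℝ → H →L[ℂ] H} (hY : WeaklyMeasurable Y) {K : ℝ}
    (hK0 : 0 ≤ K) (hK : ∀ s ∈ Icc τ t, ‖Y s‖ ≤ K) :
    ∃ T : H →L[ℂ] H, ∀ ψ ∈ M.D, ⟪ψ, T ψ⟫_ℂ = ⟪M.W τ t ψ, B (M.W τ t ψ)⟫_ℂ +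
      ∫ s in τ..t, M.phi s (Y s) (M.W s t ψ) (M.W s t ψ) := by
  have hdom : ∀ s ∈ uIcc τ t, ∀ ψ ∈ M.D, M.W s t ψ ∈ (sqrtOp M.Λ).domain := fun s hs ψ hψ => by
    rw [uIcc_of_le hτt] at hs
    exact W_mem_dom hM (hτ.trans hs.1) hs.2 hψ
  -- Domination controls only the diagonal; polarization carries integrability to the off-diagonal
  -- form.
  have hint : ∀ φ ∈ M.D, ∀ ψ ∈ M.D,
      IntervalIntegrable (fun s => M.phi s (Y s) (M.W s t φ) (M.W s t ψ)) volume τ t := by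
    intro φ hφ ψ hψ
    have hI := M.D.smul_mem Complex.I hψ
    have h1 := intervalIntegrable_phi hM hτ hτt hY hK (add_mem hφ hψ)
    have h2 := intervalIntegrable_phi hM hτ hτt hY hK (sub_mem hφ hψ)
    have h3 := intervalIntegrable_phi hM hτ hτt hY hK (add_mem hφ hI)
    have h4 := intervalIntegrable_phi hM hτ hτt hY hK (sub_mem hφ hI)
    refine IntervalIntegrable.congr (fun s hs => ?_)
      ((((h1.sub h2).sub (h3.const_mul Complex.I)).add (h4.const_mul Complex.I)).div_const 4)
    replace hs := uIoc_subset_uIcc hs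
    simp only [map_add, map_sub, map_smul]
    exact (phi_polarization s (Y s) (hdom s hs φ hφ) (hdom s hs ψ hψ)).symm
  obtain ⟨T, -, hT⟩ := exists_op_of_form (D := M.D) (dense_D hM)
    (fun φ ψ => ⟪M.W τ t φ, B (M.W τ t ψ)⟫_ℂ +
      ∫ s in τ..t, M.phi s (Y s) (M.W s t φ) (M.W s t ψ))
    (fun φ hφ φ' hφ' ψ hψ => by
      rw [map_add, inner_add_left, add_add_add_comm,
        ← intervalIntegral.integral_add (hint φ hφ ψ hψ) (hint φ' hφ' ψ hψ)]
      congr 1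
      refine intervalIntegral.integral_congr fun s hs => ?_
      simp only [map_add]
      exact phi_add_left s _ _ (hdom s hs φ hφ) (hdom s hs φ' hφ'))
    (fun a φ hφ ψ hψ => by
      rw [map_smul, inner_smul_left, mul_add, ← intervalIntegral.integral_const_mul]
      congr 1
      refine intervalIntegral.integral_congr fun s hs => ?_
      simp only [map_smul]
      exact phi_smul_left s _ a _ (hdom s hs φ hφ))
    (fun φ hφ ψ hψ ψ' hψ' => by
      rw [map_add, map_add, inner_add_right, add_add_add_comm,
        ← intervalIntegral.integral_add (hint φ hφ ψ hψ) (hint φ hφ ψ' hψ')]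
      congr 1
      refine intervalIntegral.integral_congr fun s hs => ?_
      simp only [map_add]
      exact phi_add_right s _ _ (hdom s hs ψ hψ) (hdom s hs ψ' hψ'))
    (fun a φ hφ ψ hψ => by
      rw [map_smul, map_smul, inner_smul_right, mul_add, ← intervalIntegral.integral_const_mul]
      congr 1
      refine intervalIntegral.integral_congr fun s hs => ?_
      simp only [map_smul]
      exact phi_smul_right s _ a _ (hdom s hs ψ hψ))
    (by positivity) (fun ψ hψ => norm_form_le hM hτ hτt B hK0 hK hψ)
  exact ⟨T, fun ψ hψ => hT ψ hψ ψ hψ⟩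

/-- Measurability of the form defining the next approximation. -/
theorem measurable_form (hM : M.DomainContinuity)
    [TopologicalSpace.SeparableSpace H] {τ : ℝ} (hτ : 0 ≤ τ)
    (B : H →L[ℂ] H) {Y : ℝ → H →L[ℂ] H} (hY : WeaklyMeasurable Y) (ψ : H) :
    Measurable fun t => ⟪M.W τ (max τ t) ψ, B (M.W τ (max τ t) ψ)⟫_ℂ +
      ∫ s in τ..max τ t, M.phi s (Y s) (M.W s (max τ t) ψ) (M.W s (max τ t) ψ) := by
  refine Measurable.add ?_ ?_
  · have hc : Continuous fun t => M.W τ (max τ t) ψ :=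
      (hM.evolution.continuousOn ψ).comp_continuous (f := fun t => (τ, max τ t)) (by fun_prop)
        fun t => ⟨hτ, le_max_left _ _⟩
    have : Continuous fun t => ⟪M.W τ (max τ t) ψ, B (M.W τ (max τ t) ψ)⟫_ℂ := by fun_prop
    exact this.measurable
  · let F : ℝ × ℝ → ℂ := fun p => M.phi (max 0 p.1) (Y p.1)
      (M.W (max 0 p.1) (max (max 0 p.1) p.2) ψ) (M.W (max 0 p.1) (max (max 0 p.1) p.2) ψ)
    have hF : Measurable F := measurable_phi hM hY ψ
    -- The variable interval of integration is encoded as an indicator, so that measurability of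
    -- parameter integrals over the whole line applies.
    let E : Set (ℝ × ℝ) := {p | τ < p.2 ∧ p.2 ≤ max τ p.1}
    have hE : MeasurableSet E :=
      (measurableSet_lt measurable_const measurable_snd).inter
        (measurableSet_le measurable_snd (measurable_const.max measurable_fst))
    have hG : Measurable (E.indicator fun p => F (p.2, max τ p.1)) :=
      (hF.comp (measurable_snd.prodMk (measurable_const.max measurable_fst))).indicator hE
    have := (hG.stronglyMeasurable.integral_prod_right' (ν := volume)).measurable
    convert this using 2 with t
    rw [intervalIntegral.integral_of_le (le_max_left _ _),
      ← integral_indicator measurableSet_Ioc]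
    congr 1
    funext s
    by_cases hs : s ∈ Ioc τ (max τ t)
    · have h0 : 0 ≤ s := hτ.trans hs.1.le
      rw [indicator_of_mem hs, indicator_of_mem (show (t, s) ∈ E from hs)]
      simp only [F, max_eq_right h0, max_eq_right hs.2]
    · rw [indicator_of_notMem hs, indicator_of_notMem (show (t, s) ∉ E from hs)]

theorem P_succ_of (hM : M.DomainContinuity)
    [TopologicalSpace.SeparableSpace H] {n : ℕ} {τ : ℝ} (hτ : 0 ≤ τ)
    {B : H →L[ℂ] H} {K : ℝ} (hK0 : 0 ≤ K) (hK : ∀ t, τ ≤ t → ‖M.P n τ t B‖ ≤ K)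
    (hY : WeaklyMeasurable fun t => M.P n τ (max τ t) B) {t : ℝ} (hτt : τ ≤ t) {ψ : H}
    (hψ : ψ ∈ M.D) :
    IntervalIntegrable (fun s => M.phi s (M.P n τ s B) (M.W s t ψ) (M.W s t ψ)) volume τ t ∧
    ⟪ψ, M.P (n + 1) τ t B ψ⟫_ℂ = ⟪M.W τ t ψ, B (M.W τ t ψ)⟫_ℂ +
      ∫ s in τ..t, M.phi s (M.P n τ s B) (M.W s t ψ) (M.W s t ψ) := by
  have hK' : ∀ s ∈ Icc τ t, ‖M.P n τ (max τ s) B‖ ≤ K := fun s _ => hK _ (le_max_left _ _)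
  have hcongr : ∀ φ : H, EqOn
      (fun s => M.phi s (M.P n τ (max τ s) B) (M.W s t φ) (M.W s t φ))
      (fun s => M.phi s (M.P n τ s B) (M.W s t φ) (M.W s t φ)) (uIcc τ t) := fun φ s hs => by
    rw [uIcc_of_le hτt] at hs
    simp only [max_eq_right hs.1]
  refine ⟨IntervalIntegrable.congr (fun s hs => hcongr ψ (uIoc_subset_uIcc hs))
    (intervalIntegrable_phi hM hτ hτt hY hK' hψ), ?_⟩
  rw [P]
  refine opOfForm_spec ?_ hψ
  obtain ⟨T, hT⟩ := exists_op_next hM hτ hτt B hY hK0 hK'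
  exact ⟨T, fun φ hφ => by rw [hT φ hφ, intervalIntegral.integral_congr (hcongr φ)]⟩

/-- The two properties must be carried through the induction together: both are needed at level `n`
for the form at level `n + 1` to be that of a bounded operator. The bound `K` may grow with `n`. The
clamp `max τ t` makes the family everywhere defined in time. -/
theorem P_bounded_measurable (hM : M.DomainContinuity)
    [TopologicalSpace.SeparableSpace H] (n : ℕ) {τ : ℝ} (hτ : 0 ≤ τ)
    (B : H →L[ℂ] H) : (∃ K, 0 ≤ K ∧ ∀ t, τ ≤ t → ‖M.P n τ t B‖ ≤ K) ∧
      WeaklyMeasurable fun t => M.P n τ (max τ t) B := by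
  induction n with
  | zero =>
    refine ⟨⟨‖B‖, norm_nonneg _, fun t ht => ?_⟩, ?_⟩
    · have h1 := hM.evolution.norm_le τ t hτ ht
      calc ‖star (M.W τ t) * B * M.W τ t‖ ≤ ‖star (M.W τ t)‖ * ‖B‖ * ‖M.W τ t‖ :=
            (norm_mul_le _ _).trans (by gcongr; exact norm_mul_le _ _)
        _ ≤ 1 * ‖B‖ * 1 := by
            rw [norm_star]; gcongr
        _ = ‖B‖ := by ring
    · intro x y
      have hc : ∀ ψ, Continuous fun t => M.W τ (max τ t) ψ := fun ψ =>
        (hM.evolution.continuousOn ψ).comp_continuous (f := fun t => (τ, max τ t)) (by fun_prop)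
          fun t => ⟨hτ, le_max_left _ _⟩
      have h1 := hc x
      have h2 := hc y
      have : Continuous fun t => ⟪M.W τ (max τ t) x, B (M.W τ (max τ t) y)⟫_ℂ := by fun_prop
      convert this.measurable using 2 with t
      exact inner_P_zero _ _ _ _ _
  | succ n ih =>
    obtain ⟨⟨K, hK0, hK⟩, hY⟩ := ih
    have hstep := fun {t : ℝ} (ht : τ ≤ t) {ψ : H} (hψ : ψ ∈ M.D) =>
      (P_succ_of hM hτ hK0 hK hY ht hψ).2
    refine ⟨⟨2 * (‖B‖ + 2 * K), by positivity, fun t ht => ?_⟩, ?_⟩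
    · refine norm_le_of_form (dense_D hM) (by positivity) fun ψ hψ => ?_
      rw [hstep ht hψ]
      exact norm_form_le hM hτ ht B hK0 (fun s hs => hK s hs.1) hψ
    · refine weaklyMeasurable_of_dense (dense_D hM) fun ψ hψ => ?_
      convert measurable_form hM hτ B hY ψ using 2 with t
      rw [hstep (le_max_left τ t) hψ]
      congr 1
      refine intervalIntegral.integral_congr fun s hs => ?_
      rw [uIcc_of_le (le_max_left _ _)] at hs
      simp only [max_eq_right hs.1]

theorem iteratesWellDefined (hM : M.DomainContinuity)
    [TopologicalSpace.SeparableSpace H] : M.IteratesWellDefined := by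
  intro n τ t hτ hτt B ψ hψ
  obtain ⟨⟨K, hK0, hK⟩, hY⟩ := P_bounded_measurable hM n hτ B
  exact P_succ_of hM hτ hK0 hK hY hτt hψ

end MarkovMasterEquation

namespace MarkovMasterEquation

open MME

open scoped ComplexOrder

set_option linter.unusedSectionVars false

variable {H : Type*} [NormedAddCommGroup H] [InnerProductSpace ℂ H] [CompleteSpace H]
  {M : MarkovMasterEquation H}

/-! ### Positivity, monotonicity and the minimal solution -/

theorem intervalIntegral_mono_complex {f g : ℝ → ℂ} {a b : ℝ} (hab : a ≤ b)
    (hf : IntervalIntegrable f volume a b) (hg : IntervalIntegrable g volume a b)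
    (h : ∀ s ∈ Icc a b, f s ≤ g s) : ∫ s in a..b, f s ≤ ∫ s in a..b, g s := by
  rw [intervalIntegral.integral_of_le hab, intervalIntegral.integral_of_le hab]
  refine integral_mono_ae hf.1 hg.1 ?_
  filter_upwards [ae_restrict_mem measurableSet_Ioc] with s hs using h s ⟨hs.1.le, hs.2⟩

theorem phi_mono (s : ℝ) {X Y : H →L[ℂ] H} (h : X ≤ Y) (ψ : H) :
    M.phi s X ψ ψ ≤ M.phi s Y ψ ψ :=
  inner_le_of_le (cp_mono _ h) _

theorem phi_nonneg (s : ℝ) {X : H →L[ℂ] H} (h : 0 ≤ X) (ψ : H) : 0 ≤ M.phi s X ψ ψ :=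
  inner_nonneg_of_nonneg (cp_nonneg _ h) _

theorem phi_add (s : ℝ) (X Y : H →L[ℂ] H) (φ ψ : H) :
    M.phi s (X + Y) φ ψ = M.phi s X φ ψ + M.phi s Y φ ψ := by
  rw [phi, map_add, add_apply, inner_add_right]; rfl

theorem phi_smul (s : ℝ) (a : ℂ) (X : H →L[ℂ] H) (φ ψ : H) :
    M.phi s (a • X) φ ψ = a * M.phi s X φ ψ := by
  rw [phi, map_smul, smul_apply, inner_smul_right]; rfl

theorem integral_phi_nonneg {τ t : ℝ}
    (hτt : τ ≤ t) {Y : ℝ → H →L[ℂ] H} (h0 : ∀ s ∈ Icc τ t, 0 ≤ Y s) {ψ : H}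
    (hi : IntervalIntegrable (fun s => M.phi s (Y s) (M.W s t ψ) (M.W s t ψ)) volume τ t) :
    0 ≤ ∫ s in τ..t, M.phi s (Y s) (M.W s t ψ) (M.W s t ψ) := by
  have := intervalIntegral_mono_complex hτt intervalIntegrable_const hi
    (f := fun _ => 0) fun s hs => phi_nonneg s (h0 s hs) _
  simpa using this

theorem intervalIntegrable_phi_const (hM : M.DomainContinuity)
    [TopologicalSpace.SeparableSpace H] {τ t : ℝ} (hτ : 0 ≤ τ)
    (hτt : τ ≤ t) (X : H →L[ℂ] H) {ψ : H} (hψ : ψ ∈ M.D) :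
    IntervalIntegrable (fun s => M.phi s X (M.W s t ψ) (M.W s t ψ)) volume τ t :=
  intervalIntegrable_phi hM hτ hτt (weaklyMeasurable_const X) (K := ‖X‖) (fun _ _ => le_rfl) hψ

theorem P_nonneg (hM : M.DomainContinuity)
    [TopologicalSpace.SeparableSpace H] (n : ℕ) {τ t : ℝ} (hτ : 0 ≤ τ)
    (hτt : τ ≤ t) {B : H →L[ℂ] H} (hB : 0 ≤ B) : 0 ≤ M.P n τ t B := by
  induction n generalizing t with
  | zero =>
    refine nonneg_of_dense dense_univ fun ψ _ => ?_
    rw [inner_P_zero]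
    exact inner_nonneg_of_nonneg hB _
  | succ n ih =>
    refine nonneg_of_dense (dense_D hM) fun ψ hψ => ?_
    obtain ⟨hi, he⟩ := iteratesWellDefined hM n τ t hτ hτt B ψ hψ
    rw [he]
    exact add_nonneg (inner_nonneg_of_nonneg hB _)
      (integral_phi_nonneg hτt (fun s hs => ih hs.1) hi)

theorem P_le_succ (hM : M.DomainContinuity)
    [TopologicalSpace.SeparableSpace H] (n : ℕ) {τ t : ℝ} (hτ : 0 ≤ τ)
    (hτt : τ ≤ t) {B : H →L[ℂ] H} (hB : 0 ≤ B) : M.P n τ t B ≤ M.P (n + 1) τ t B := by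
  induction n generalizing t with
  | zero =>
    refine le_of_dense (dense_D hM) fun ψ hψ => ?_
    obtain ⟨hi, he⟩ := iteratesWellDefined hM 0 τ t hτ hτt B ψ hψ
    rw [he, inner_P_zero]
    exact le_add_of_nonneg_right
      (integral_phi_nonneg hτt (fun s hs => P_nonneg hM 0 hτ hs.1 hB) hi)
  | succ n ih =>
    refine le_of_dense (dense_D hM) fun ψ hψ => ?_
    obtain ⟨hi, he⟩ := iteratesWellDefined hM n τ t hτ hτt B ψ hψ
    obtain ⟨hi', he'⟩ := iteratesWellDefined hM (n + 1) τ t hτ hτt B ψ hψ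
    rw [he, he']
    gcongr
    exact intervalIntegral_mono_complex hτt hi hi' fun s hs => phi_mono s (ih hs.1) _

theorem P_monotone (hM : M.DomainContinuity)
    [TopologicalSpace.SeparableSpace H] {τ t : ℝ} (hτ : 0 ≤ τ)
    (hτt : τ ≤ t) {B : H →L[ℂ] H} (hB : 0 ≤ B) : Monotone fun n => M.P n τ t B :=
  monotone_nat_of_le_succ fun n => P_le_succ hM n hτ hτt hB

/-- The bound `b • 1` reproduces itself under the recursion: by the energy balance, `b‖W τ t ψ‖² + b
∫ Φₛ(I)[W s t ψ] ds = b‖ψ‖²`. -/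
theorem P_le_smul_one (hM : M.DomainContinuity)
    [TopologicalSpace.SeparableSpace H] (n : ℕ) {τ t : ℝ} (hτ : 0 ≤ τ)
    (hτt : τ ≤ t) {B : H →L[ℂ] H} {b : ℂ} (hb : 0 ≤ b) (hB : B ≤ b • 1) :
    M.P n τ t B ≤ b • 1 := by
  have hBW : ∀ v : H, ⟪v, B v⟫_ℂ ≤ b * ⟪v, v⟫_ℂ := fun v => by
    have := inner_le_of_le hB v
    rwa [smul_apply, inner_smul_right, one_apply_eq_self] at this
  induction n generalizing t with
  | zero =>
    refine le_of_dense (dense_D hM) fun ψ hψ => ?_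
    have h1 := integral_phi_one hM hτ hτt hψ
    have h2 := integral_phi_nonneg hτt (fun _ _ => zero_le_one)
      (intervalIntegrable_phi_const hM hτ hτt 1 hψ)
    rw [h1, sub_nonneg] at h2
    rw [inner_P_zero, smul_apply, inner_smul_right, one_apply_eq_self]
    exact (hBW _).trans (mul_le_mul_of_nonneg_left h2 hb)
  | succ n ih =>
    refine le_of_dense (dense_D hM) fun ψ hψ => ?_
    obtain ⟨hi, he⟩ := iteratesWellDefined hM n τ t hτ hτt B ψ hψ
    have h1 := integral_phi_one hM hτ hτt hψ
    have h2 := intervalIntegral_mono_complex hτt hi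
      (intervalIntegrable_phi_const hM hτ hτt (b • 1) hψ) fun s hs => phi_mono s (ih hs.1) _
    simp only [phi_smul] at h2
    rw [intervalIntegral.integral_const_mul, h1] at h2
    rw [he, smul_apply, inner_smul_right, one_apply_eq_self]
    refine (add_le_add (hBW _) h2).trans_eq ?_
    ring

/-- Convergence of the forms is kept alongside the order statement because it lets form bounds on
`P⁽ⁿ⁾` pass to the limit. -/
theorem isLUB_Pmin_and_tendsto (hM : M.DomainContinuity)
    [TopologicalSpace.SeparableSpace H] {τ t : ℝ} (hτ : 0 ≤ τ)
    (hτt : τ ≤ t) {B : H →L[ℂ] H} (hB : 0 ≤ B) :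
    IsLUB (range fun n => M.P n τ t B) (M.Pmin τ t B) ∧
      ∀ ψ, Tendsto (fun n => ⟪ψ, M.P n τ t B ψ⟫_ℂ) atTop (𝓝 ⟪ψ, M.Pmin τ t B ψ⟫_ℂ) := by
  obtain ⟨T, hT, hlim⟩ : ∃ T, IsLUB (range fun n => M.P n τ t B) T ∧
      ∀ ψ, Tendsto (fun n => ⟪ψ, M.P n τ t B ψ⟫_ℂ) atTop (𝓝 ⟪ψ, T ψ⟫_ℂ) := by
    refine exists_isLUB_of_monotone (P_monotone hM hτ hτt hB) (fun n => P_nonneg hM n hτ hτt hB)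
      (norm_nonneg B) fun n ψ => ?_
    have hle : B ≤ ((‖B‖ : ℝ) : ℂ) • (1 : H →L[ℂ] H) := by
      have := IsSelfAdjoint.le_algebraMap_norm_self (IsSelfAdjoint.of_nonneg hB)
      rwa [Algebra.algebraMap_eq_smul_one] at this
    have h := re_inner_le (P_le_smul_one hM n hτ hτt
      (Complex.zero_le_real.2 (norm_nonneg B)) hle) ψ
    rwa [smul_apply, inner_smul_right, one_apply_eq_self, Complex.re_ofReal_mul,
      ← RCLike.re_to_complex (x := ⟪ψ, ψ⟫_ℂ), ← norm_sq_eq_re_inner] at h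
  have hex : ∃ T, IsLUB (range fun n => M.P n τ t B) T := ⟨T, hT⟩
  have hPmin : M.Pmin τ t B = T := by
    rw [Pmin, dif_pos hex]
    exact hex.choose_spec.unique hT
  rw [hPmin]
  exact ⟨hT, hlim⟩

end MarkovMasterEquation

namespace MarkovMasterEquation

open MME

open scoped ComplexOrder

set_option linter.unusedSectionVars false

variable {H : Type*} [NormedAddCommGroup H] [InnerProductSpace ℂ H] [CompleteSpace H]
  {M : MarkovMasterEquation H} {L : ℝ → (H →ₗ.[ℂ] H)} {c : ℝ → ℝ}

/-! ### The reference family along the evolution -/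

theorem IsReferenceFamily.intervalIntegrable_rate (hL : M.IsReferenceFamily L c) {a b : ℝ}
    (ha : 0 ≤ a) (hab : a ≤ b) : IntervalIntegrable c volume a b := by
  rw [intervalIntegrable_iff_integrableOn_Icc_of_le hab]
  exact hL.rate_integrable.integrableOn_compact_subset (fun s hs => ha.trans hs.1) isCompact_Icc

/-- The form of a bounded positive operator dominated on `D` by a multiple of `L s` is mapped by
`Φₛ` below the same multiple of `Φₛ(L s)`. -/
theorem IsReferenceFamily.phi_re_le (hL : M.IsReferenceFamily L c) {s : ℝ} (hs : 0 ≤ s)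
    {X : H →L[ℂ] H} (hX : 0 ≤ X) {a : ℝ} (ha : 0 < a)
    (hXL : ∀ φ ∈ M.D, (⟪φ, X φ⟫_ℂ).re ≤ a * ‖ev (sqrtOp (L s)) φ‖ ^ 2) {ψ : H} (hψ : ψ ∈ M.D) :
    a⁻¹ * (M.phi s X ψ ψ).re ≤ (M.phiExt s (L s) ψ).toReal := by
  have h1 : 0 ≤ ((a⁻¹ : ℝ) : ℂ) • X :=
    smul_nonneg (Complex.zero_le_real.2 (inv_nonneg.2 ha.le)) hX
  have h2 : LeOp (((a⁻¹ : ℝ) : ℂ) • X) (L s) := by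
    intro x
    -- The core property carries the bound from `D` to all of `dom Lₛ`, as required for `a⁻¹ X` to
    -- compete in the supremum defining `Φₛ(Lₛ)`.
    have h3 := le_form_of_core (hL.core s hs) hXL ((hL.ge_one s hs).domain_le x.2)
    have h4 := (hL.ge_one s hs).inner_ev x.2
    rw [ev_of_mem x.2] at h4
    rw [smul_apply, inner_smul_right, Complex.re_ofReal_mul, h4, Complex.ofReal_re,
      inv_mul_le_iff₀ ha]
    exact h3
  have h5 : ENNReal.ofReal (M.phi s (((a⁻¹ : ℝ) : ℂ) • X) ψ ψ).re ≤ M.phiExt s (L s) ψ :=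
    le_iSup_of_le (((a⁻¹ : ℝ) : ℂ) • X) (le_iSup_of_le h1 (le_iSup_of_le h2 le_rfl))
  rw [phi_smul, Complex.re_ofReal_mul] at h5
  exact (ENNReal.ofReal_le_iff_le_toReal (hL.inequality s hs ψ hψ).1).1 h5

/-- Lower bound for the lower right Dini derivative of `‖L s ^ {1/2} W s t ψ‖²`. -/
theorem dini_reference (hM : M.DomainContinuity) (hL : M.IsReferenceFamily L c)
    {s t : ℝ} (hs : 0 ≤ s) (hst : s < t) {ψ : H} (hψ : ψ ∈ M.D) {y : ℝ}
    (hy : -(2 * (⟪ev (M.G s) (M.W s t ψ), ev (L s) (M.W s t ψ)⟫_ℂ).re +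
      (⟪M.W s t ψ, derivWithin (fun r => ev (L r) (M.W s t ψ)) (Ici 0) s⟫_ℂ).re) < y) :
    ∀ᶠ r in 𝓝[>] s, -‖ev (sqrtOp (L r)) (M.W r t ψ)‖ ^ 2 - -‖ev (sqrtOp (L s)) (M.W s t ψ)‖ ^ 2 ≤
      (r - s) * y := by
  set u := M.W s t ψ with hu
  have huD : u ∈ M.D := W_mem hM hs hst.le hψ
  have hform : ∀ r, 0 ≤ r → ∀ v ∈ M.D,
      ‖ev (sqrtOp (L r)) v‖ ^ 2 = (⟪v, ev (L r) v⟫_ℂ).re := fun r hr v hv => by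
    rw [(hL.ge_one r hr).inner_ev (hL.D_le r hr hv), Complex.ofReal_re]
  have hdW : HasDerivWithinAt (fun r => M.W r t ψ) (ev (M.G s) u) (Ioi s) s :=
    hasDerivWithinAt_W hM hs hst hψ
  have hdL : HasDerivWithinAt (fun r => ev (L r) u)
      (derivWithin (fun r => ev (L r) u) (Ici 0) s) (Ioi s) s :=
    ((hL.differentiable u huD s hs).hasDerivWithinAt).mono fun r hr => hs.trans (le_of_lt hr)
  -- With `w = W r t ψ - u`, this is `⟨u + w, Lᵣ (u + w)⟩` without `⟨w, Lᵣ w⟩`, up to an imaginary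
  -- part. Here `Lᵣ` acts only on the fixed vector `u`, so `h` is differentiable; the omitted term
  -- is nonnegative, so `re h` is a minorant that touches at `r = s`.
  set h : ℝ → ℂ := fun r => ⟪u, ev (L r) u⟫_ℂ + 2 * ⟪M.W r t ψ - u, ev (L r) u⟫_ℂ with hh
  have hdh : HasDerivWithinAt h (⟪u, derivWithin (fun r => ev (L r) u) (Ici 0) s⟫_ℂ +
      2 * ⟪ev (M.G s) u, ev (L s) u⟫_ℂ) (Ioi s) s := by
    have h1 := ((hasDerivWithinAt_const s (Ioi s) u).inner ℂ hdL).add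
      (((hdW.sub_const u).inner ℂ hdL).const_mul 2)
    convert! h1 using 1
    simp [← hu]
  have hdn : HasDerivWithinAt (fun r => -(h r).re)
      (-(⟪u, derivWithin (fun r => ev (L r) u) (Ici 0) s⟫_ℂ +
      2 * ⟪ev (M.G s) u, ev (L s) u⟫_ℂ).re) (Ioi s) s := by
    have := (Complex.reCLM.hasFDerivAt.comp_hasDerivWithinAt s hdh).neg
    exact this
  have hlt : -(⟪u, derivWithin (fun r => ev (L r) u) (Ici 0) s⟫_ℂ +
      2 * ⟪ev (M.G s) u, ev (L s) u⟫_ℂ).re < y := by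
    refine lt_of_eq_of_lt ?_ hy
    simp
    ring
  filter_upwards [hdn.limsup_slope_le' (notMem_Ioi.2 le_rfl) hlt, Ioc_mem_nhdsGT hst] with r hr hrt
  have hr0 : 0 ≤ r := hs.trans hrt.1.le
  have hslope : -(h r).re - -(h s).re ≤ (r - s) * y := by
    have := mul_le_mul_of_nonneg_left hr.le (sub_pos.2 hrt.1).le
    rwa [← smul_eq_mul, sub_smul_slope] at this
  have hrD : M.W r t ψ ∈ M.D := W_mem hM hr0 hrt.2 hψ
  have hs' : (h s).re = ‖ev (sqrtOp (L s)) u‖ ^ 2 := by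
    rw [hform s hs u huD]
    simp [hh, ← hu]
  have hr' : (h r).re ≤ ‖ev (sqrtOp (L r)) (M.W r t ψ)‖ ^ 2 := by
    rw [hform r hr0 _ hrD]
    set w := M.W r t ψ - u with hw
    have hwD : w ∈ M.D := sub_mem hrD huD
    have hwu : M.W r t ψ = u + w := by rw [hw]; abel
    have hud := hL.D_le r hr0 huD
    have hwd := hL.D_le r hr0 hwD
    have hpos : 0 ≤ (⟪w, ev (L r) w⟫_ℂ).re := by
      rw [← hform r hr0 w hwD]; positivity
    have hsym : (⟪u, ev (L r) w⟫_ℂ).re = (⟪w, ev (L r) u⟫_ℂ).re := by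
      rw [← inner_ev_left (hL.ge_one r hr0).isSelfAdjoint hud hwd, ← inner_conj_symm,
        Complex.conj_re]
    rw [hwu, ev_add hud hwd]
    simp only [hh, ← hw, inner_add_left, inner_add_right, Complex.add_re, hsym]
    have h2 : (2 * ⟪w, ev (L r) u⟫_ℂ).re = 2 * (⟪w, ev (L r) u⟫_ℂ).re := by simp
    rw [h2]
    linarith
  linarith

/-- The integrated differential inequality. -/
theorem reference_integral_le (hM : M.DomainContinuity) (hL : M.IsReferenceFamily L c)
    [TopologicalSpace.SeparableSpace H] {κ : ℝ} (hκ : 0 ≤ κ) {τ t : ℝ}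
    (hτ : 0 ≤ τ) (hτt : τ ≤ t) {Y : ℝ → H →L[ℂ] H} (hY : ∀ s ∈ Icc τ t, 0 ≤ Y s)
    (hYL : ∀ s ∈ Icc τ t, ∀ φ ∈ M.D, (⟪φ, Y s φ⟫_ℂ).re ≤
      Real.exp (∫ r in τ..s, (c r + κ)) * ‖ev (sqrtOp (L s)) φ‖ ^ 2) {ψ : H} (hψ : ψ ∈ M.D)
    (hi : IntervalIntegrable (fun s => (M.phi s (Y s) (M.W s t ψ) (M.W s t ψ)).re) volume τ t) :
    ‖ev (sqrtOp (L τ)) (M.W τ t ψ)‖ ^ 2 +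
      ∫ s in τ..t, ((M.phi s (Y s) (M.W s t ψ) (M.W s t ψ)).re +
        κ * ‖ev (sqrtOp (L s)) (M.W s t ψ)‖ ^ 2) ≤
      Real.exp (∫ r in τ..t, (c r + κ)) * ‖ev (sqrtOp (L t)) ψ‖ ^ 2 := by
  set f : ℝ → ℝ := fun s => ‖ev (sqrtOp (L s)) (M.W s t ψ)‖ ^ 2 with hf
  set q : ℝ → ℝ := fun s => (M.phi s (Y s) (M.W s t ψ) (M.W s t ψ)).re + κ * f s with hq
  have hfc : ContinuousOn f (Icc τ t) :=
    (hL.continuous_along ψ hψ t (hτ.trans hτt)).mono (Icc_subset_Icc hτ le_rfl)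
  have hfi : IntervalIntegrable f volume τ t :=
    ContinuousOn.intervalIntegrable (by rwa [uIcc_of_le hτt])
  have hci : IntervalIntegrable (fun r => c r + κ) volume τ t :=
    (hL.intervalIntegrable_rate hτ hτt).add intervalIntegrable_const
  have hc0 : ∀ s ∈ Icc τ t, 0 ≤ c s + κ := fun s hs =>
    add_nonneg (hL.rate_nonneg s (hτ.trans hs.1)) hκ
  have hqi : IntervalIntegrable q volume τ t := hi.add (hfi.const_mul κ)
  have hC : ContinuousOn (fun s => ∫ r in τ..s, (c r + κ)) (Icc τ t) := by
    have := intervalIntegral.continuousOn_primitive_interval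
      (f := fun r => c r + κ) (a := τ) (b := t) (μ := volume) (by
        rw [uIcc_of_le hτt, ← intervalIntegrable_iff_integrableOn_Icc_of_le hτt]; exact hci)
    rwa [uIcc_of_le hτt] at this
  have hgi : IntervalIntegrable
      (fun r => Real.exp (-∫ x in τ..r, (c x + κ)) * q r - (c r + κ) * f r) volume τ t := by
    refine (hqi.continuousOn_mul ?_).sub (hci.mul_continuousOn ?_) <;> rw [uIcc_of_le hτt]
    · exact Real.continuous_exp.comp_continuousOn hC.neg
    · exact hfc
  have main := integral_le_exp_mul_sub hτt hfc hci hqi hc0 fun s hs => ?_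
  · have ht : f t = ‖ev (sqrtOp (L t)) ψ‖ ^ 2 := by
      simp [hf, hM.evolution.refl t (hτ.trans hτt)]
    rw [ht] at main
    change f τ + _ ≤ _
    linarith
  · have hgs : IntegrableOn
        (fun r => -(Real.exp (-∫ x in τ..r, (c x + κ)) * q r - (c r + κ) * f r)) (Icc s t) := by
      rw [intervalIntegrable_iff_integrableOn_Icc_of_le hτt] at hgi
      exact (hgi.mono_set (Icc_subset_Icc hs.1 le_rfl)).neg
    have hd := sub_le_integral_of_dini_le (g := fun r => -f r) hs.2
      (hfc.mono (Icc_subset_Icc hs.1 le_rfl)).neg hgs fun x hx y hy => ?_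
    · rw [intervalIntegral.integral_neg] at hd
      linarith
    · have hx0 : 0 ≤ x := hτ.trans (hs.1.trans hx.1)
      have hxm : x ∈ Icc τ t := ⟨hs.1.trans hx.1, hx.2.le⟩
      refine dini_reference hM hL hx0 hx.2 hψ (lt_of_le_of_lt ?_ hy)
      have hWD := W_mem hM hx0 hx.2.le hψ
      have h1 := (hL.inequality x hx0 _ hWD).2
      have h2 := hL.phi_re_le hx0 (hY x hxm) (Real.exp_pos _) (hYL x hxm) hWD
      have hC0 : 0 ≤ ∫ r in τ..x, (c r + κ) :=
        intervalIntegral.integral_nonneg hxm.1 fun r hr => hc0 r ⟨hr.1, hr.2.trans hxm.2⟩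
      -- In the integrated inequality the rate `c + κ` subtracts `κ f`, which outweighs the
      -- discounted source `exp(-∫ (c + κ)) κ f` because the exponent is nonpositive.
      have h3 : Real.exp (-∫ r in τ..x, (c r + κ)) * (κ * f x) ≤ κ * f x :=
        mul_le_of_le_one_left (mul_nonneg hκ (by positivity)) (Real.exp_le_one_iff.2 (by linarith))
      rw [← Real.exp_neg] at h2
      rw [neg_le_neg_iff, hq]
      change (M.phiExt x (L x) (M.W x t ψ)).toReal - _ - _ ≤ c x * f x at h1
      rw [mul_add, add_mul]
      linarith

end MarkovMasterEquation

namespace MarkovMasterEquation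

open MME

open scoped ComplexOrder

set_option linter.unusedSectionVars false

variable {H : Type*} [NormedAddCommGroup H] [InnerProductSpace ℂ H] [CompleteSpace H]
  {M : MarkovMasterEquation H} {L : ℝ → (H →ₗ.[ℂ] H)} {c : ℝ → ℝ}

/-! ### The a priori bound -/

theorem intervalIntegrable_re {f : ℝ → ℂ} {a b : ℝ} (hf : IntervalIntegrable f volume a b) :
    IntervalIntegrable (fun s => (f s).re) volume a b := by
  rw [intervalIntegrable_iff] at hf ⊢
  exact hf.re

theorem re_intervalIntegral {f : ℝ → ℂ} {a b : ℝ} (hf : IntervalIntegrable f volume a b) :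
    (∫ s in a..b, f s).re = ∫ s in a..b, (f s).re :=
  (Complex.reCLM.intervalIntegral_comp_comm hf).symm

theorem P_le_reference (hM : M.DomainContinuity) (hL : M.IsReferenceFamily L c)
    [TopologicalSpace.SeparableSpace H] (n : ℕ) {τ t : ℝ} (hτ : 0 ≤ τ)
    (hτt : τ ≤ t) {X : H →L[ℂ] H} (hX : 0 ≤ X) (hXL : LeOp X (L τ)) {ψ : H} (hψ : ψ ∈ M.D) :
    (⟪ψ, M.P n τ t X ψ⟫_ℂ).re ≤
      Real.exp (∫ s in τ..t, c s) * ‖ev (sqrtOp (L t)) ψ‖ ^ 2 := by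
  have hinit : ∀ {t ψ}, τ ≤ t → ψ ∈ M.D → (⟪M.W τ t ψ, X (M.W τ t ψ)⟫_ℂ).re ≤
      ‖ev (sqrtOp (L τ)) (M.W τ t ψ)‖ ^ 2 := fun {t ψ} ht hψ => by
    have hd := hL.D_le τ hτ (W_mem hM hτ ht hψ)
    have h1 := hXL ⟨_, hd⟩
    have h2 := (hL.ge_one τ hτ).inner_ev hd
    rw [ev_of_mem hd] at h2
    rwa [h2, Complex.ofReal_re] at h1
  induction n generalizing t ψ with
  | zero =>
    -- With `Y = 0` the estimate says that the reference form grows at most exponentially along `W`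
    -- alone.
    have h := reference_integral_le hM hL le_rfl hτ hτt (Y := fun _ => 0) (fun _ _ => le_rfl)
      (fun s hs φ _ => by simp only [zero_apply, inner_zero_right, Complex.zero_re]; positivity)
      hψ (intervalIntegrable_re (intervalIntegrable_phi_const hM hτ hτt 0 hψ))
    rw [inner_P_zero]
    refine (hinit hτt hψ).trans ?_
    simpa [phi] using h
  | succ n ih =>
    obtain ⟨hi, he⟩ := iteratesWellDefined hM n τ t hτ hτt X ψ hψ
    have h := reference_integral_le hM hL le_rfl hτ hτt (Y := fun s => M.P n τ s X)
      (fun s hs => P_nonneg hM n hτ hs.1 hX)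
      (fun s hs φ hφ => by simpa using ih hs.1 hφ) hψ (intervalIntegrable_re hi)
    simp only [zero_mul, add_zero] at h
    rw [he, Complex.add_re, re_intervalIntegral hi]
    linarith [hinit hτt hψ]

/-- For fixed `X` the bound holds on the core for every `n`; it is extended to the form domain
before the limit in `n`, and the supremum over `X` comes last. -/
theorem PminExt_le (hM : M.DomainContinuity) (hL : M.IsReferenceFamily L c)
    [TopologicalSpace.SeparableSpace H] {τ t : ℝ} (hτ : 0 ≤ τ) (hτt : τ ≤ t)
    {ψ : H} (hψ : ψ ∈ (sqrtOp (L t)).domain) :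
    M.PminExt τ t (L τ) ψ ≤
      ENNReal.ofReal (Real.exp (∫ s in τ..t, c s) * ‖ev (sqrtOp (L t)) ψ‖ ^ 2) := by
  refine iSup_le fun X => iSup_le fun hX => iSup_le fun hXL => ENNReal.ofReal_le_ofReal ?_
  refine le_of_tendsto ((Complex.continuous_re.tendsto _).comp
    ((isLUB_Pmin_and_tendsto hM hτ hτt hX).2 ψ)) (Eventually.of_forall fun n => ?_)
  exact le_form_of_core (hL.core t (hτ.trans hτt))
    (fun φ hφ => P_le_reference hM hL n hτ hτt hX hXL hφ) hψ

/-! ### Unitality -/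

/-- The expected number of jumps, truncated, is bounded by the reference family. -/
theorem sum_defect_le (hM : M.DomainContinuity) (hL : M.IsReferenceFamily L c)
    [TopologicalSpace.SeparableSpace H] (n : ℕ) {τ t : ℝ} (hτ : 0 ≤ τ)
    (hτt : τ ≤ t) {ψ : H} (hψ : ψ ∈ M.D) :
    (⟪ψ, (∑ k ∈ Finset.range n, (1 - M.P k τ t 1)) ψ⟫_ℂ).re ≤
      Real.exp (∫ s in τ..t, (c s + 1)) * ‖ev (sqrtOp (L t)) ψ‖ ^ 2 := by
  induction n generalizing t ψ with
  | zero =>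
    simp only [Finset.range_zero, Finset.sum_empty, zero_apply, inner_zero_right, Complex.zero_re]
    positivity
  | succ n ih =>
    have hone := intervalIntegrable_phi_const hM hτ hτt 1 hψ
    have hP := fun k => iteratesWellDefined hM k τ t hτ hτt 1 ψ hψ
    have hsub : ∀ k s, M.phi s (1 - M.P k τ s 1) (M.W s t ψ) (M.W s t ψ) =
        M.phi s 1 (M.W s t ψ) (M.W s t ψ) -
          M.phi s (M.P k τ s 1) (M.W s t ψ) (M.W s t ψ) := fun k s => by
      rw [eq_sub_iff_add_eq, ← phi_add, sub_add_cancel]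
    have hki : ∀ k, IntervalIntegrable
        (fun s => M.phi s (1 - M.P k τ s 1) (M.W s t ψ) (M.W s t ψ)) volume τ t := fun k => by
      simp only [hsub]
      exact hone.sub (hP k).1
    have hzero : ⟪ψ, (1 - M.P 0 τ t 1) ψ⟫_ℂ =
        ∫ s in τ..t, M.phi s 1 (M.W s t ψ) (M.W s t ψ) := by
      rw [sub_apply, inner_sub_right, inner_P_zero, integral_phi_one hM hτ hτt hψ]
      rfl
    have hsucc : ∀ k, ⟪ψ, (1 - M.P (k + 1) τ t 1) ψ⟫_ℂ =
        ∫ s in τ..t, M.phi s (1 - M.P k τ s 1) (M.W s t ψ) (M.W s t ψ) := fun k => by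
      simp only [hsub]
      rw [intervalIntegral.integral_sub hone (hP k).1, sub_apply, inner_sub_right, (hP k).2,
        integral_phi_one hM hτ hτt hψ, one_apply_eq_self, one_apply_eq_self]
      ring
    have hphisum : ∀ s, M.phi s (∑ k ∈ Finset.range n, (1 - M.P k τ s 1)) (M.W s t ψ)
        (M.W s t ψ) =
        ∑ k ∈ Finset.range n, M.phi s (1 - M.P k τ s 1) (M.W s t ψ) (M.W s t ψ) := fun s => by
      simp only [phi]
      rw [map_sum, sum_apply, inner_sum]
    have hsumi : IntervalIntegrable (fun s =>
        M.phi s (∑ k ∈ Finset.range n, (1 - M.P k τ s 1)) (M.W s t ψ) (M.W s t ψ)) volume τ t := by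
      simp only [hphisum]
      have h := IntervalIntegrable.sum (Finset.range n) fun k _ => hki k
      convert! h using 1
      funext s
      rw [Finset.sum_apply]
    -- The partial sums `S_n` of the defects shift: `S_{n+1}` is the `k = 0` defect, equal to `∫
    -- Φₛ(I)`, plus the image of `S_n` under the recursion.
    have hform : ⟪ψ, (∑ k ∈ Finset.range (n + 1), (1 - M.P k τ t 1)) ψ⟫_ℂ =
        (∫ s in τ..t, M.phi s (∑ k ∈ Finset.range n, (1 - M.P k τ s 1)) (M.W s t ψ)
          (M.W s t ψ)) + ∫ s in τ..t, M.phi s 1 (M.W s t ψ) (M.W s t ψ) := by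
      rw [sum_apply, inner_sum, Finset.sum_range_succ', hzero]
      congr 1
      simp only [hphisum]
      rw [intervalIntegral.integral_finsetSum fun k _ => hki k]
      exact Finset.sum_congr rfl fun k _ => hsucc k
    -- The choice `κ = 1` leaves the term `∫ ‖Lₛ^{1/2} W s t ψ‖² ds` on the left, which dominates
    -- the source `∫ Φₛ(I)[W s t ψ] ds`.
    have h := reference_integral_le hM hL zero_le_one hτ hτt
      (Y := fun s => ∑ k ∈ Finset.range n, (1 - M.P k τ s 1))
      (fun s hs => Finset.sum_nonneg fun k _ => sub_nonneg.2 (by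
        simpa using P_le_smul_one hM k hτ hs.1 zero_le_one (B := 1) (b := 1) (by simp)))
      (fun s hs φ hφ => ih hs.1 hφ) hψ (intervalIntegrable_re hsumi)
    have hfi : IntervalIntegrable (fun s => 1 * ‖ev (sqrtOp (L s)) (M.W s t ψ)‖ ^ 2)
        volume τ t := by
      refine IntervalIntegrable.const_mul (ContinuousOn.intervalIntegrable ?_) 1
      rw [uIcc_of_le hτt]
      exact (hL.continuous_along ψ hψ t (hτ.trans hτt)).mono (Icc_subset_Icc hτ le_rfl)
    have hle : ∫ s in τ..t, (M.phi s 1 (M.W s t ψ) (M.W s t ψ)).re ≤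
        ∫ s in τ..t, 1 * ‖ev (sqrtOp (L s)) (M.W s t ψ)‖ ^ 2 := by
      refine intervalIntegral.integral_mono_on hτt (intervalIntegrable_re hone) hfi fun s hs => ?_
      rw [one_mul]
      have h0 := hτ.trans hs.1
      exact hL.phi_one_le s h0 _ (W_mem hM h0 hs.2 hψ)
    rw [intervalIntegral.integral_add (intervalIntegrable_re hsumi) hfi] at h
    rw [hform, Complex.add_re, re_intervalIntegral hsumi, re_intervalIntegral hone]
    linarith [sq_nonneg ‖ev (sqrtOp (L τ)) (M.W τ t ψ)‖]

/-- Each defect `1 - P⁽ᵏ⁾(1)` dominates the limit defect, so a positive value of the latter on some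
`ψ ∈ D` would make the partial sums grow linearly in `n`, against their uniform bound. -/
theorem Pmin_one (hM : M.DomainContinuity) (hL : M.IsReferenceFamily L c)
    [TopologicalSpace.SeparableSpace H] {τ t : ℝ} (hτ : 0 ≤ τ) (hτt : τ ≤ t) :
    M.Pmin τ t 1 = 1 := by
  have hlub := (isLUB_Pmin_and_tendsto hM hτ hτt (zero_le_one (α := H →L[ℂ] H))).1
  have hle : M.Pmin τ t 1 ≤ 1 := hlub.2 (by
    rintro _ ⟨n, rfl⟩
    simpa using P_le_smul_one hM n hτ hτt zero_le_one (B := 1) (b := 1) (by simp))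
  have h0 : 0 ≤ 1 - M.Pmin τ t 1 := sub_nonneg.2 hle
  suffices h : 1 - M.Pmin τ t 1 = 0 from (sub_eq_zero.1 h).symm
  refine eq_of_dense (dense_D hM) fun ψ hψ => ?_
  rw [zero_apply, inner_zero_right, ← ofReal_re_inner (IsSelfAdjoint.of_nonneg h0),
    Complex.ofReal_eq_zero]
  refine le_antisymm ?_ (re_inner_nonneg h0 ψ)
  by_contra hpos
  rw [not_le] at hpos
  obtain ⟨n, hn⟩ := exists_nat_gt
    (Real.exp (∫ s in τ..t, (c s + 1)) * ‖ev (sqrtOp (L t)) ψ‖ ^ 2 /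
      (⟪ψ, (1 - M.Pmin τ t 1) ψ⟫_ℂ).re)
  rw [div_lt_iff₀ hpos] at hn
  have h1 := sum_defect_le hM hL n hτ hτt hψ
  have h2 : (n : ℝ) * (⟪ψ, (1 - M.Pmin τ t 1) ψ⟫_ℂ).re ≤
      (⟪ψ, (∑ k ∈ Finset.range n, (1 - M.P k τ t 1)) ψ⟫_ℂ).re := by
    rw [sum_apply, inner_sum, Complex.re_sum]
    have := Finset.card_nsmul_le_sum (Finset.range n)
      (fun k => (⟪ψ, (1 - M.P k τ t 1) ψ⟫_ℂ).re) (⟪ψ, (1 - M.Pmin τ t 1) ψ⟫_ℂ).re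
      fun k _ => re_inner_le (sub_le_sub_left (hlub.1 ⟨k, rfl⟩) 1) ψ
    simpa only [Finset.card_range, nsmul_eq_mul] using this
  linarith

end MarkovMasterEquation

end

end Development

theorem theorem2p1 {H : Type*} [NormedAddCommGroup H] [InnerProductSpace ℂ H] [CompleteSpace H]
    [TopologicalSpace.SeparableSpace H] (M : MarkovMasterEquation H) (hM : M.DomainContinuity)
    (L : ℝ → (H →ₗ.[ℂ] H)) (c : ℝ → ℝ) (hL : M.IsReferenceFamily L c) :
    M.IteratesWellDefined ∧
    (∀ τ t : ℝ, 0 ≤ τ → τ ≤ t → ∀ B : H →L[ℂ] H, 0 ≤ B →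
      IsLUB (Set.range fun n => M.P n τ t B) (M.Pmin τ t B)) ∧
    (∀ τ t : ℝ, 0 ≤ τ → τ ≤ t → ∀ ψ ∈ (MME.sqrtOp (L t)).domain,
      M.PminExt τ t (L τ) ψ ≤
        ENNReal.ofReal (Real.exp (∫ s in τ..t, c s) * ‖MME.ev (MME.sqrtOp (L t)) ψ‖ ^ 2)) ∧
    (∀ τ t : ℝ, 0 ≤ τ → τ ≤ t → M.Pmin τ t 1 = 1) := by
  exact ⟨MarkovMasterEquation.iteratesWellDefined hM,
    fun τ t hτ hτt B hB => (MarkovMasterEquation.isLUB_Pmin_and_tendsto hM hτ hτt hB).1,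
    fun τ t hτ hτt ψ hψ => MarkovMasterEquation.PminExt_le hM hL hτ hτt hψ,
    fun τ t hτ hτt => MarkovMasterEquation.Pmin_one hM hL hτ hτt⟩
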